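/- Let $\mathcal S$ be a finite or countable set, $p=(p_{jk})_{j,k\in\mathcal S}$ an irreducible and recurrent stochastic matrix, and $(m_j)_{j\in\mathcal S}$ a stationary measure of $p$ with $m_j>0$ for all $j$. For a probability measure $\mu$ on $\mathcal S$, the two-sided Markov chain with transition matrix $p$ and initial distribution $\mu$ is the process $(X_n)_{n\in\mathbb Z}$ such that $X_0$ has law $\mu$ and, given $X_0$, the processes $(X_n)_{n\ge 0}$ and $(X_{-n})_{n\ge 0}$ are independent Markov chains with transition matrix $p$ and with the dual transition matrix $p^*_{jk}=\frac{m_k}{m_j}p_{kj}$, respectively; that is, for all integers $a,b\ge0$ and all $x_{-a},\dots,x_b\in\mathcal S$, $$\mathbb P(X_k=x_k,\ -a\le k\le b)=\mu_{x_0}\prod_{k=0}^{b-1}p_{x_kx_{k+1}}\prod_{k=0}^{a-1}p^*_{x_{-k}x_{-k-1}}.$$ For $j\in\mathcal S$ and finite $A\subset\mathbb Z$ let $L^j(A)=\frac1{m_j}\#\{n\in A: X_n=j\}$. Theorem. Let $X$ be the two-sided Markov chain with transition matrix $p$ and initial state $X_0=i$, defined on a probability space with probability measure $\mathbb P_i$,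 and let $\nu=(\nu_j)_{j\in\mathcal S}$ be a probability measure on $\mathcal S$ with $\nu_i=0$ and $\frac{m_i}{m_j}\nu_j\in\mathbb Z$ for all $j\in\mathcal S$. Let $$T_*=\min\Big\{n\ge 0:\ L^i([0,n])\le\sum_{j\in\mathcal S}\nu_j L^j([0,n])\Big\},\qquad \min\emptyset=\infty,$$ where $[0,n]=\{0,1,\dots,n\}$. Then: 1. $T_*<\infty$ $\mathbb P_i$-almost surely; 2. $T_*$ is non-randomized, i.e. a measurable function of the trajectory $(X_n)_{n\in\mathbb Z}$; 3. $T_*$ is a stopping time with respect to the filtration $\sigma(X_0,\dots,X_n)$, $n\ge0$; 4. $T_*$ is an unbiased shift embedding $\nu$: under $\mathbb P_i$, the process $(X_{n+T_*})_{n\in\mathbb Z}$ is the two-sided Markov chain with transition matrix $p$ and initial distribution $\nu$; in particular $X_{T_*}$ has law $\nu$. -/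

import Mathlib

open MeasureTheory ProbabilityTheory

namespace TwoSidedChain

/-- A stochastic matrix on a (finite or countable) state space. -/
structure IsStochastic {S : Type*} (p : Matrix S S ℝ) : Prop where
  nonneg : ∀ i j, 0 ≤ p i j
  row_sum : ∀ i, HasSum (p i) 1

/-- `firstPassage p j n i` is the probability that the chain with transition matrix `p`
started in `i` visits `j` for the first time after time zero at time `n + 1`. -/
noncomputable def firstPassage {S : Type*} [DecidableEq S] (p : Matrix S S ℝ) (j : S) :
    ℕ → S → ℝ
  | 0, i => p i j
  | n + 1, i => ∑' k, if k = j then 0 else p i k * firstPassage p j n k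

/-- Every state is revisited in finite time with probability one. -/
def IsRecurrent {S : Type*} [DecidableEq S] (p : Matrix S S ℝ) : Prop :=
  ∀ i, HasSum (fun n => firstPassage p i n i) 1

/-- `m` is a stationary measure of `p` with positive weights (possibly of infinite total mass). -/
structure IsStationary {S : Type*} (p : Matrix S S ℝ) (m : S → ℝ) : Prop where
  pos : ∀ i, 0 < m i
  stationary : ∀ j, HasSum (fun i => m i * p i j) (m j)

/-- A probability measure on `S`, given by its weights. -/
structure IsProbability {S : Type*} (μ : S → ℝ) : Prop where
  nonneg : ∀ j, 0 ≤ μ j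
  sum_one : HasSum μ 1

/-- The dual transition probabilities `p*ᵢⱼ = (mⱼ / mᵢ) pⱼᵢ`. -/
noncomputable def dual {S : Type*} (p : Matrix S S ℝ) (m : S → ℝ) : Matrix S S ℝ :=
  fun i j => m j / m i * p j i

/-- Under `P`, the process `X` is the two-sided Markov chain with transition matrix `p` and initial
distribution `μ`: `X 0` has law `μ` and, given `X 0`, the forward chain `(X n)_{n ≥ 0}` and the
backward chain `(X (-n))_{n ≥ 0}` are independent Markov chains with transition matrix `p`,
respectively with the dual transition matrix. This is expressed by the probabilities of all
cylinder sets on the time windows `[-a, b]`. -/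
structure IsTwoSidedMarkovChain {S Ω : Type*} [MeasurableSpace S] [MeasurableSpace Ω]
    (p : Matrix S S ℝ) (m μ : S → ℝ) (X : ℤ → Ω → S) (P : Measure Ω) : Prop where
  measurable : ∀ n, Measurable (X n)
  cylinder : ∀ (a b : ℕ) (x : ℤ → S),
    P.real {ω | ∀ k : ℤ, -(a : ℤ) ≤ k → k ≤ (b : ℤ) → X k ω = x k} =
      μ (x 0) * (∏ k ∈ Finset.range b, p (x (k : ℤ)) (x ((k : ℤ) + 1))) *
        ∏ k ∈ Finset.range a, dual p m (x (-(k : ℤ))) (x (-(k : ℤ) - 1))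

/-- The local time `Lʲ(A) = #{n ∈ A : wₙ = j} / mⱼ` of the trajectory `w` at the state `j`,
for a finite set `A` of times. -/
noncomputable def localTime {S : Type*} [DecidableEq S] (m : S → ℝ) (w : ℤ → S) (j : S)
    (A : Finset ℤ) : ℝ :=
  ((A.filter fun n => w n = j).card : ℝ) / m j

/-- `T_* = min {n ≥ 0 : Lⁱ([0,n]) ≤ ∑ⱼ νⱼ Lʲ([0,n])}` as a function of the trajectory, with value
`⊤` if there is no such `n`. The sum over `j` has only finitely many nonzero terms. -/
noncomputable def Tstar {S : Type*} [DecidableEq S] (m ν : S → ℝ) (i : S) (w : ℤ → S) : ℕ∞ :=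
  sInf {t : ℕ∞ | ∃ n : ℕ, t = n ∧
    localTime m w i (Finset.Icc 0 (n : ℤ)) ≤ ∑' j, ν j * localTime m w j (Finset.Icc 0 (n : ℤ))}

/-- The filtration `ℱₙ = σ(X₀, …, Xₙ)`, `n ≥ 0`. It is contained in the filtration
`σ(Xₖ : k ≤ n)`, so stopping times of the former are stopping times of the latter. -/
def forwardFiltration {S Ω : Type*} [MeasurableSpace S] [mΩ : MeasurableSpace Ω]
    (X : ℤ → Ω → S) (hX : ∀ n, Measurable (X n)) : Filtration ℕ mΩ where
  seq n := ⨆ k : ℕ, ⨆ _ : k ≤ n, MeasurableSpace.comap (X k) inferInstance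
  mono' _ _ hab := biSup_mono fun _ hk => le_trans hk hab
  le' _ := iSup₂_le fun k _ => (hX k).comap_le

end TwoSidedChain

/-! Put `c j = m i / m j * ν j`, a natural number, and give each visit to `i` the charge `1` and
each visit to `j ≠ i` the charge `-c j`. Then `T_*` is the first time at which the charge
accumulated from time `0` on is nonpositive (`localTime_le_iff`), and the charge is balanced: `∑ m y
* c y = m i`.

Finiteness (`eternalSurvival_eq_zero`). Let `w x d` be the probability that the charge, started at
level `d` in state `x`, stays positive forever. As `d → ∞` it increases to a bounded harmonic
function, which recurrence forces to be constant. A truncated sum of `w` over levels is a bounded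
function with telescoping drift; its mean drift under `m` vanishes
(`tsum_stationary_mul_sub_eq_zero`). In the limit the balance of charges leaves `m i * w i 1 = 0`.

Law of the shifted process. The chain started in `i` has density `1 / m i` on `{X 0 = i}` with
respect to the shift-invariant path weights of `m`. Summing the event "`T_* = n` and the window
around `T_*` is `x`" over `n` therefore counts the visits to `i` whose charge runs out exactly at
the centre of `x`. As in a matching of brackets, there are at most `c y` of them if `y` is the
central state (`card_filter_first_nonpos_le`), so the sum is at most `c y / m i = ν y / m y` times
the weight of `x` (`sum_measure_Tstar_le`). Both sides have total mass one over all `x`, so equality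
holds. -/

namespace TwoSidedChain

/-! ### Excursions, uniqueness of the stationary measure, and the Liouville property. -/

section Excursion

open Filter Topology

variable {S : Type*} {p : Matrix S S ℝ}

/-- A property that is inherited by predecessors and holds somewhere holds everywhere. -/
theorem forall_of_irreducible_backward (hirr : p.IsIrreducible) {Q : S → Prop} {i : S} (hi : Q i)
    (hQ : ∀ x y, 0 < p x y → Q y → Q x) (x : S) : Q x := by
  let : Quiver S := Matrix.toQuiver p
  obtain ⟨q, -⟩ := hirr.connected x i
  induction q with
  | nil => exact hi
  | cons _ e ih => exact ih (hQ _ _ e.down hi)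

theorem IsStochastic.summable_mul (hp : IsStochastic p) {φ : S → ℝ} {C : ℝ} (hφ : ∀ y, |φ y| ≤ C)
    (x : S) : Summable fun y => p x y * φ y := by
  refine Summable.of_norm_bounded ((hp.row_sum x).summable.mul_right C) fun y => ?_
  rw [norm_mul, Real.norm_of_nonneg (hp.nonneg x y)]
  exact mul_le_mul_of_nonneg_left (hφ y) (hp.nonneg x y)

theorem IsStochastic.abs_tsum_mul_le (hp : IsStochastic p) {φ : S → ℝ} {C : ℝ}
    (hφ : ∀ y, |φ y| ≤ C) (x : S) : |∑' y, p x y * φ y| ≤ C := by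
  have h := tsum_of_norm_bounded (f := fun y => p x y * φ y) ((hp.row_sum x).mul_right C)
    fun y => by
      rw [norm_mul, Real.norm_of_nonneg (hp.nonneg x y)]
      exact mul_le_mul_of_nonneg_left (hφ y) (hp.nonneg x y)
  simpa using h

theorem summable_mul_of_abs_le {g φ : S → ℝ} {C : ℝ} (hg : ∀ x, 0 ≤ g x) (hgs : Summable g)
    (hφ : ∀ y, |φ y| ≤ C) : Summable fun y => g y * φ y := by
  refine Summable.of_norm_bounded (hgs.mul_right C) fun y => ?_
  rw [norm_mul, Real.norm_of_nonneg (hg y)]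
  exact mul_le_mul_of_nonneg_left (hφ y) (hg y)

theorem abs_tsum_mul_le {g φ : S → ℝ} {C : ℝ} (hg : ∀ x, 0 ≤ g x) (hgs : Summable g)
    (hφ : ∀ y, |φ y| ≤ C) : |∑' y, g y * φ y| ≤ (∑' y, g y) * C := by
  refine tsum_of_norm_bounded (f := fun y => g y * φ y) (hgs.hasSum.mul_right C) fun y => ?_
  rw [norm_mul, Real.norm_of_nonneg (hg y)]
  exact mul_le_mul_of_nonneg_left (hφ y) (hg y)

theorem summable_uncurry_of_nonneg {α β : Type*} {f : α → β → ℝ} (h0 : ∀ a b, 0 ≤ f a b)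
    (h1 : ∀ a, Summable (f a)) (h2 : Summable fun a => ∑' b, f a b) :
    Summable fun z : α × β => f z.1 z.2 :=
  (summable_prod_of_nonneg (f := fun z : α × β => f z.1 z.2) (by intro z; exact h0 _ _)).2 ⟨h1, h2⟩

theorem IsStochastic.summable_prod (hp : IsStochastic p) {g : S → ℝ}
    (hg : ∀ x, 0 ≤ g x) (hgs : Summable g) :
    Summable fun z : S × S => g z.1 * p z.1 z.2 := by
  refine summable_uncurry_of_nonneg (f := fun x y => g x * p x y)
    (fun x y => mul_nonneg (hg x) (hp.nonneg x y))
    (fun x => (hp.row_sum x).summable.mul_left _) ?_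
  simpa [tsum_mul_left, (hp.row_sum _).tsum_eq] using hgs

theorem IsStochastic.summable_prod_mul (hp : IsStochastic p) {g φ : S → ℝ} {C : ℝ}
    (hg : ∀ x, 0 ≤ g x) (hgs : Summable g) (hφ : ∀ y, |φ y| ≤ C) :
    Summable fun z : S × S => g z.1 * p z.1 z.2 * φ z.2 :=
  summable_mul_of_abs_le (g := fun z : S × S => g z.1 * p z.1 z.2) (φ := fun z => φ z.2)
    (fun _ => mul_nonneg (hg _) (hp.nonneg _ _)) (hp.summable_prod hg hgs) fun z => hφ z.2

theorem IsStochastic.tsum_mul_tsum (hp : IsStochastic p) {g φ : S → ℝ} {C : ℝ}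
    (hg : ∀ x, 0 ≤ g x) (hgs : Summable g) (hφ : ∀ y, |φ y| ≤ C) :
    ∑' x, g x * ∑' y, p x y * φ y = ∑' y, (∑' x, g x * p x y) * φ y := by
  have h := (hp.summable_prod_mul hg hgs hφ).tsum_comm (f := fun x y => g x * p x y * φ y)
  simp_rw [← tsum_mul_left, ← tsum_mul_right, ← mul_assoc]
  exact h.symm

theorem IsStochastic.summable_tsum_mul (hp : IsStochastic p) {g : S → ℝ}
    (hg : ∀ x, 0 ≤ g x) (hgs : Summable g) : Summable fun y => ∑' x, g x * p x y :=
  (hp.summable_prod hg hgs).prod_symm.prod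

variable [DecidableEq S]

/-- `excursion p i n y` is the probability that the chain started in `i` is in `y` at time `n`
without having returned to `i` at the times `1, …, n`. -/
noncomputable def excursion (p : Matrix S S ℝ) (i : S) : ℕ → S → ℝ
  | 0, y => if y = i then 1 else 0
  | n + 1, y => if y = i then 0 else ∑' x, excursion p i n x * p x y

theorem excursion_nonneg (hp : IsStochastic p) (i : S) (n : ℕ) (y : S) :
    0 ≤ excursion p i n y := by
  induction n generalizing y with
  | zero => simp only [excursion]; split_ifs <;> simp
  | succ n ih =>
    simp only [excursion]
    split_ifs
    · exact le_rfl
    · exact tsum_nonneg fun x => mul_nonneg (ih x) (hp.nonneg _ _)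

theorem summable_excursion (hp : IsStochastic p) (i : S) (n : ℕ) :
    Summable (excursion p i n) := by
  induction n with
  | zero => exact summable_of_ne_finset_zero (s := {i}) fun y hy => by simp_all [excursion]
  | succ n ih =>
    refine Summable.of_nonneg_of_le (excursion_nonneg hp i (n + 1)) (fun y => ?_)
      (hp.summable_tsum_mul (excursion_nonneg hp i n) ih)
    simp only [excursion]
    split_ifs
    · exact tsum_nonneg fun x => mul_nonneg (excursion_nonneg hp i n x) (hp.nonneg _ _)
    · exact le_rfl

theorem tsum_excursion_zero_mul (i : S) (φ : S → ℝ) : ∑' x, excursion p i 0 x * φ x = φ i := by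
  rw [tsum_eq_single i fun y hy => by simp [excursion, hy]]
  simp [excursion]

/-- One more step of the excursion, split according to whether it returns to `i`. -/
theorem tsum_excursion_mul_tsum (hp : IsStochastic p) (i : S) (n : ℕ) {φ : S → ℝ} {C : ℝ}
    (hφ : ∀ y, |φ y| ≤ C) :
    ∑' x, excursion p i n x * ∑' y, p x y * φ y =
      ∑' y, excursion p i (n + 1) y * φ y + (∑' x, excursion p i n x * p x i) * φ i := by
  have he := excursion_nonneg hp i n
  have hs := summable_excursion hp i n
  rw [hp.tsum_mul_tsum he hs hφ]
  have h1 : Summable fun y => (∑' x, excursion p i n x * p x y) * φ y :=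
    summable_mul_of_abs_le (fun y => tsum_nonneg fun x => mul_nonneg (he x) (hp.nonneg _ _))
      (hp.summable_tsum_mul he hs) hφ
  rw [h1.tsum_eq_add_tsum_ite i, add_comm]
  congr 1
  refine tsum_congr fun y => ?_
  by_cases h : y = i <;> simp [excursion, h]

theorem firstPassage_nonneg (hp : IsStochastic p) (i : S) (n : ℕ) (x : S) :
    0 ≤ firstPassage p i n x := by
  induction n generalizing x with
  | zero => exact hp.nonneg _ _
  | succ n ih =>
    refine tsum_nonneg fun k => ?_
    split_ifs
    · exact le_rfl
    · exact mul_nonneg (hp.nonneg _ _) (ih k)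

theorem firstPassage_succ_eq (i : S) (n : ℕ) (x : S) :
    firstPassage p i (n + 1) x = ∑' y, p x y * (if y = i then 0 else firstPassage p i n y) :=
  tsum_congr fun y => by split_ifs <;> simp

theorem abs_firstPassage_le (hp : IsStochastic p) (i : S) (n : ℕ) (x : S) :
    |firstPassage p i n x| ≤ 1 := by
  induction n generalizing x with
  | zero =>
    rw [abs_of_nonneg (firstPassage_nonneg hp i 0 x), ← (hp.row_sum x).tsum_eq]
    exact (hp.row_sum x).summable.le_tsum i fun j _ => hp.nonneg x j
  | succ n ih =>
    rw [firstPassage_succ_eq]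
    refine hp.abs_tsum_mul_le (fun y => ?_) x
    split_ifs
    · simp
    · exact ih y

/-- Markov property at time `n`, before the first return to `i`. -/
theorem tsum_excursion_mul_firstPassage (hp : IsStochastic p) (i : S) (n k : ℕ) :
    ∑' x, excursion p i n x * firstPassage p i k x = firstPassage p i (n + k) i := by
  induction n generalizing k with
  | zero => rw [tsum_excursion_zero_mul, zero_add]
  | succ n ih =>
    have hb : ∀ y, |if y = i then 0 else firstPassage p i k y| ≤ 1 := fun y => by
      split_ifs
      · simp
      · exact abs_firstPassage_le hp i k y
    have h := tsum_excursion_mul_tsum hp i n hb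
    simp_rw [← firstPassage_succ_eq, ih (k + 1)] at h
    rw [show n + 1 + k = n + (k + 1) by ring, h]
    simp only [if_true, mul_zero, add_zero]
    refine tsum_congr fun y => ?_
    by_cases hy : y = i <;> simp [excursion, hy]

theorem tsum_excursion_mul_apply (hp : IsStochastic p) (i : S) (n : ℕ) :
    ∑' x, excursion p i n x * p x i = firstPassage p i n i :=
  tsum_excursion_mul_firstPassage hp i n 0

/-- Dynkin's formula for the chain started in `i` and stopped at the first return or at time `N`,
whichever is earlier. -/
theorem sum_tsum_excursion_mul_sub (hp : IsStochastic p) (i : S) (N : ℕ) {φ : S → ℝ} {C : ℝ}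
    (hφ : ∀ y, |φ y| ≤ C) :
    ∑ n ∈ Finset.range N, ∑' x, excursion p i n x * (∑' y, p x y * φ y - φ x) =
      ∑' x, excursion p i N x * φ x -
        φ i * (1 - ∑ n ∈ Finset.range N, firstPassage p i n i) := by
  induction N with
  | zero => simp [tsum_excursion_zero_mul]
  | succ N ih =>
    have he := excursion_nonneg hp i N
    have hs := summable_excursion hp i N
    rw [Finset.sum_range_succ, ih, Finset.sum_range_succ]
    simp_rw [mul_sub]
    rw [Summable.tsum_sub (summable_mul_of_abs_le he hs (hp.abs_tsum_mul_le hφ))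
      (summable_mul_of_abs_le he hs hφ), tsum_excursion_mul_tsum hp i N hφ,
      tsum_excursion_mul_apply hp]
    ring

theorem tsum_excursion (hp : IsStochastic p) (i : S) (N : ℕ) :
    ∑' x, excursion p i N x = 1 - ∑ n ∈ Finset.range N, firstPassage p i n i := by
  have h := sum_tsum_excursion_mul_sub hp i N (φ := fun _ => 1) (C := 1) (by simp)
  simp only [mul_one, (hp.row_sum _).tsum_eq, sub_self, mul_zero, tsum_zero,
    Finset.sum_const_zero, one_mul] at h
  linarith

theorem tendsto_one_sub_sum_firstPassage (hrec : IsRecurrent p) (i : S) :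
    Tendsto (fun N => 1 - ∑ n ∈ Finset.range N, firstPassage p i n i) atTop (𝓝 0) := by
  simpa using (hrec i).tendsto_sum_nat.const_sub 1

theorem tendsto_sum_tsum_excursion_mul_sub (hp : IsStochastic p) (hrec : IsRecurrent p) (i : S)
    {φ : S → ℝ} {C : ℝ} (hφ : ∀ y, |φ y| ≤ C) :
    Tendsto (fun N => ∑ n ∈ Finset.range N,
      ∑' x, excursion p i n x * (∑' y, p x y * φ y - φ x)) atTop (𝓝 0) := by
  simp_rw [sum_tsum_excursion_mul_sub hp i _ hφ]
  have h0 := tendsto_one_sub_sum_firstPassage hrec i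
  have h1 : Tendsto (fun N => ∑' x, excursion p i N x * φ x) atTop (𝓝 0) := by
    refine squeeze_zero_norm (fun N => ?_) (by simpa using h0.mul_const C)
    rw [← tsum_excursion hp]
    exact abs_tsum_mul_le (excursion_nonneg hp i N) (summable_excursion hp i N) hφ
  simpa using h1.sub (h0.const_mul (φ i))

variable {m : S → ℝ}

/-- Away from `i`, the occupation up to `N + 1` is the image under `p` of the occupation up to `N`,
and stationarity carries the bound by `m` through `p`. At `i` only time `0` contributes. -/
theorem sum_excursion_le (hp : IsStochastic p) (hm : IsStationary p m) (i : S) (N : ℕ) (x : S) :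
    m i * ∑ n ∈ Finset.range N, excursion p i n x ≤ m x := by
  induction N generalizing x with
  | zero => simpa using (hm.pos x).le
  | succ N ih =>
    rw [Finset.sum_range_succ']
    by_cases hx : x = i
    · simp [excursion, hx]
    · simp only [excursion, hx, if_false, add_zero]
      have hs : ∀ n, Summable fun y => excursion p i n y * p y x := fun n => by
        refine summable_mul_of_abs_le (C := 1) (excursion_nonneg hp i n)
          (summable_excursion hp i n) fun y => ?_
        rw [abs_of_nonneg (hp.nonneg y x), ← (hp.row_sum y).tsum_eq]
        exact (hp.row_sum y).summable.le_tsum x fun j _ => hp.nonneg y j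
      rw [← Summable.tsum_finsetSum fun n _ => hs n, ← tsum_mul_left,
        ← (hm.stationary x).tsum_eq]
      refine Summable.tsum_le_tsum (fun y => ?_)
        ((summable_sum fun n _ => hs n).mul_left _) (hm.stationary x).summable
      rw [← Finset.sum_mul, ← mul_assoc]
      exact mul_le_mul_of_nonneg_right (ih y) (hp.nonneg y x)

theorem summable_excursion_time (hp : IsStochastic p) (hm : IsStationary p m) (i x : S) :
    Summable fun n => excursion p i n x := by
  refine summable_of_sum_range_le (c := m x / m i) (fun n => excursion_nonneg hp i n x)
    fun N => ?_
  rw [le_div_iff₀' (hm.pos i)]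
  exact sum_excursion_le hp hm i N x

/-- The occupation measure `g` of an excursion is invariant (at `i` because return is certain), lies
below `m` and agrees with `m` at `i`. The invariant measure `m - g ≥ 0` vanishes at every
predecessor of a zero, hence everywhere. -/
theorem hasSum_excursion (hp : IsStochastic p) (hirr : p.IsIrreducible) (hrec : IsRecurrent p)
    (hm : IsStationary p m) (i x : S) :
    HasSum (fun n => m i * excursion p i n x) (m x) := by
  have hsum := summable_excursion_time hp hm i
  set g : S → ℝ := fun x => m i * ∑' n, excursion p i n x with hg
  have hle : ∀ x, g x ≤ m x := fun x =>
    le_of_tendsto' ((hsum x).hasSum.tendsto_sum_nat.const_mul (m i))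
      fun N => sum_excursion_le hp hm i N x
  have hg0 : ∀ x, 0 ≤ g x := fun x =>
    mul_nonneg (hm.pos i).le (tsum_nonneg fun n => excursion_nonneg hp i n x)
  have hgs : ∀ y, Summable fun x => g x * p x y := fun y =>
    Summable.of_nonneg_of_le (fun x => mul_nonneg (hg0 x) (hp.nonneg _ _))
      (fun x => mul_le_mul_of_nonneg_right (hle x) (hp.nonneg _ _)) (hm.stationary y).summable
  have hgi : g i = m i := by
    simp only [hg]
    rw [tsum_eq_single 0 fun n hn => by
      obtain ⟨k, rfl⟩ := Nat.exists_eq_succ_of_ne_zero hn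
      simp [excursion]]
    simp [excursion]
  have hginv : ∀ y, ∑' x, g x * p x y = g y := by
    intro y
    have hprod : Summable fun z : S × ℕ => m i * excursion p i z.2 z.1 * p z.1 y := by
      refine summable_uncurry_of_nonneg (f := fun x n => m i * excursion p i n x * p x y)
        (fun x n => mul_nonneg (mul_nonneg (hm.pos i).le (excursion_nonneg hp i n x))
          (hp.nonneg x y)) (fun x => ((hsum x).mul_left _).mul_right _) ?_
      simpa [tsum_mul_left, tsum_mul_right] using hgs y
    have hcomm := hprod.tsum_comm (f := fun x n => m i * excursion p i n x * p x y)
    simp_rw [tsum_mul_right, tsum_mul_left] at hcomm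
    change _ = ∑' x, g x * p x y at hcomm
    rw [← hcomm]
    simp_rw [mul_assoc, tsum_mul_left]
    by_cases hy : y = i
    · subst hy
      simp_rw [tsum_excursion_mul_apply hp, (hrec y).tsum_eq, hgi, mul_one]
    · simp only [hg]
      rw [(hsum y).tsum_eq_zero_add]
      simp [excursion, hy]
  have key : ∀ x, g x = m x := by
    refine forall_of_irreducible_backward hirr hgi fun x y hxy hy => ?_
    have h1 : HasSum (fun x => (m x - g x) * p x y) 0 := by
      have := (hm.stationary y).sub (hgs y).hasSum
      rw [hginv, hy, sub_self] at this
      simpa [sub_mul] using this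
    have h2 := (hasSum_zero_iff_of_nonneg fun x =>
      mul_nonneg (sub_nonneg.2 (hle x)) (hp.nonneg x y)).1 h1
    have h3 : (m x - g x) * p x y = 0 := congrFun h2 x
    rcases mul_eq_zero.1 h3 with h | h
    · linarith
    · exact absurd h hxy.ne'
  rw [← key x]
  exact (hsum x).hasSum.mul_left _

/-- A bounded function whose one-step drift is integrable against the stationary measure of a
recurrent chain has mean drift zero. -/
theorem tsum_stationary_mul_sub_eq_zero (hp : IsStochastic p) (hirr : p.IsIrreducible)
    (hrec : IsRecurrent p) (hm : IsStationary p m) [Nonempty S] {φ : S → ℝ} {C : ℝ}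
    (hφ : ∀ y, |φ y| ≤ C) (hs : Summable fun x => m x * |∑' y, p x y * φ y - φ x|) :
    ∑' x, m x * (∑' y, p x y * φ y - φ x) = 0 := by
  obtain ⟨i⟩ := ‹Nonempty S›
  set ψ : S → ℝ := fun x => ∑' y, p x y * φ y - φ x
  have hes := hasSum_excursion hp hirr hrec hm i
  -- Integrability of the drift allows the sums over states and excursion times to be exchanged;
  -- Dynkin's formula then gives the limit of the partial sums over time.
  have hprod : Summable fun z : S × ℕ => m i * excursion p i z.2 z.1 * ψ z.1 := by
    refine Summable.of_norm (f := fun z : S × ℕ => m i * excursion p i z.2 z.1 * ψ z.1) ?_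
    have : (fun z : S × ℕ => ‖m i * excursion p i z.2 z.1 * ψ z.1‖) =
        fun z : S × ℕ => m i * excursion p i z.2 z.1 * |ψ z.1| := by
      funext z
      rw [norm_mul, Real.norm_of_nonneg (mul_nonneg (hm.pos i).le (excursion_nonneg hp i _ _)),
        Real.norm_eq_abs]
    rw [this]
    refine summable_uncurry_of_nonneg (f := fun x n => m i * excursion p i n x * |ψ x|)
      (fun x n => mul_nonneg (mul_nonneg (hm.pos i).le (excursion_nonneg hp i n x))
        (abs_nonneg _)) (fun x => (hes x).summable.mul_right _) ?_
    simpa only [tsum_mul_right, (hes _).tsum_eq] using hs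
  have hcomm := hprod.tsum_comm (f := fun x n => m i * excursion p i n x * ψ x)
  simp_rw [tsum_mul_right, (hes _).tsum_eq] at hcomm
  rw [← hcomm]
  have h1 : HasSum (fun n => ∑' x, m i * excursion p i n x * ψ x)
      (∑' n, ∑' x, m i * excursion p i n x * ψ x) := hprod.prod_symm.prod.hasSum
  have h2 := (tendsto_sum_tsum_excursion_mul_sub hp hrec i hφ).const_mul (m i)
  refine tendsto_nhds_unique h1.tendsto_sum_nat ?_
  simpa only [mul_zero, Finset.mul_sum, ← tsum_mul_left, ← mul_assoc] using h2

/-- A bounded subharmonic function of a recurrent chain is harmonic. -/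
theorem harmonic_of_subharmonic (hp : IsStochastic p) (hrec : IsRecurrent p) {φ : S → ℝ} {C : ℝ}
    (hφ : ∀ y, |φ y| ≤ C) (hsub : ∀ x, φ x ≤ ∑' y, p x y * φ y) (x : S) :
    ∑' y, p x y * φ y = φ x := by
  have hlim := tendsto_sum_tsum_excursion_mul_sub hp hrec x hφ
  have hnn : ∀ n, 0 ≤ ∑' z, excursion p x n z * (∑' y, p z y * φ y - φ z) := fun n =>
    tsum_nonneg fun z => mul_nonneg (excursion_nonneg hp x n z) (sub_nonneg.2 (hsub z))
  -- The time-`0` term is the drift at `x` itself; it is bounded by nonnegative partial sums tending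
  -- to `0`.
  have h0 : ∑' z, excursion p x 0 z * (∑' y, p z y * φ y - φ z) ≤ 0 := by
    refine ge_of_tendsto hlim (eventually_atTop.2 ⟨1, fun N hN => ?_⟩)
    exact Finset.single_le_sum (f := fun n => ∑' z, excursion p x n z *
      (∑' y, p z y * φ y - φ z)) (fun n _ => hnn n) (Finset.mem_range.2 hN)
  rw [tsum_excursion_zero_mul] at h0
  linarith [hsub x]

/-- Liouville property: bounded harmonic functions of an irreducible recurrent chain are
constant. -/
theorem eq_of_harmonic (hp : IsStochastic p) (hirr : p.IsIrreducible)
    (hrec : IsRecurrent p) {v : S → ℝ} {C : ℝ}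
    (hv : ∀ y, |v y| ≤ C) (hharm : ∀ x, ∑' y, p x y * v y = v x) (i x : S) : v x = v i := by
  have hb : ∀ y, |v y ^ 2| ≤ C ^ 2 := fun y => by
    rw [abs_pow]; exact pow_le_pow_left₀ (abs_nonneg _) (hv y) 2
  -- The one-step variance of `v` is the drift of `v ^ 2`. So `v ^ 2` is subharmonic, hence
  -- harmonic, and the variance vanishes: `v` is constant along possible transitions.
  have hvar : ∀ x, HasSum (fun y => p x y * (v y - v x) ^ 2)
      (∑' y, p x y * v y ^ 2 - v x ^ 2) := fun x => by
    have h := ((hp.summable_mul hb x).hasSum.sub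
      ((hp.summable_mul hv x).hasSum.mul_right (2 * v x))).add
      ((hp.row_sum x).mul_right (v x ^ 2))
    rw [hharm] at h
    rw [show (fun y => p x y * (v y - v x) ^ 2) = fun y =>
        p x y * v y ^ 2 - p x y * v y * (2 * v x) + p x y * v x ^ 2 from funext fun y => by ring,
      show ∑' y, p x y * v y ^ 2 - v x ^ 2 =
        ∑' y, p x y * v y ^ 2 - v x * (2 * v x) + 1 * v x ^ 2 by ring]
    exact h
  have hnn : ∀ x y, 0 ≤ p x y * (v y - v x) ^ 2 := fun x y =>
    mul_nonneg (hp.nonneg _ _) (sq_nonneg _)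
  have hsq := harmonic_of_subharmonic hp hrec hb fun x => by
    linarith [(hvar x).nonneg (hnn x)]
  refine forall_of_irreducible_backward hirr (Q := fun x => v x = v i) rfl
    (fun x y hxy hy => ?_) x
  have h0 := hvar x
  rw [hsq, sub_self] at h0
  have h1 : p x y * (v y - v x) ^ 2 = 0 :=
    congrFun ((hasSum_zero_iff_of_nonneg (hnn x)).1 h0) y
  rcases mul_eq_zero.1 h1 with h | h
  · exact absurd h hxy.ne'
  · rw [← hy]
    linarith [pow_eq_zero_iff (two_ne_zero) |>.1 h]

end Excursion

/-! ### Survival probabilities of the accumulated charge. -/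

section Survival

open Filter Topology

variable {S : Type*} {p : Matrix S S ℝ}

/-- `survival p f n x d` is the probability that for the chain `Y` with transition matrix `p`
started in `x` all the sums `d + f Y₁ + … + f Yₖ`, `k ≤ n`, are positive. -/
noncomputable def survival (p : Matrix S S ℝ) (f : S → ℤ) : ℕ → S → ℤ → ℝ
  | 0, _, d => if 0 < d then 1 else 0
  | n + 1, x, d => if 0 < d then ∑' y, p x y * survival p f n y (d + f y) else 0

variable {f : S → ℤ}

theorem survival_of_nonpos (n : ℕ) (x : S) {d : ℤ} (hd : d ≤ 0) : survival p f n x d = 0 := by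
  cases n <;> simp [survival, hd.not_gt]

theorem survival_succ_of_pos (n : ℕ) (x : S) {d : ℤ} (hd : 0 < d) :
    survival p f (n + 1) x d = ∑' y, p x y * survival p f n y (d + f y) := by
  simp [survival, hd]

theorem survival_nonneg (hp : IsStochastic p) (n : ℕ) (x : S) (d : ℤ) :
    0 ≤ survival p f n x d := by
  induction n generalizing x d with
  | zero => simp only [survival]; split_ifs <;> simp
  | succ n ih =>
    simp only [survival]
    split_ifs
    · exact tsum_nonneg fun y => mul_nonneg (hp.nonneg _ _) (ih _ _)
    · exact le_rfl

theorem survival_le_one (hp : IsStochastic p) (n : ℕ) (x : S) (d : ℤ) :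
    survival p f n x d ≤ 1 := by
  induction n generalizing x d with
  | zero => simp only [survival]; split_ifs <;> simp
  | succ n ih =>
    simp only [survival]
    split_ifs
    · exact (le_abs_self _).trans (hp.abs_tsum_mul_le (fun y => by
        rw [abs_of_nonneg (survival_nonneg hp n _ _)]; exact ih _ _) x)
    · exact zero_le_one

theorem abs_survival_le_one (hp : IsStochastic p) (n : ℕ) (x : S) (d : ℤ) :
    |survival p f n x d| ≤ 1 := by
  rw [abs_of_nonneg (survival_nonneg hp n x d)]; exact survival_le_one hp n x d

theorem summable_mul_survival (hp : IsStochastic p) (n : ℕ) (x : S) (d : ℤ) :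
    Summable fun y => p x y * survival p f n y (d + f y) :=
  hp.summable_mul (fun _ => abs_survival_le_one hp n _ _) x

theorem survival_succ_le (hp : IsStochastic p) (n : ℕ) (x : S) (d : ℤ) :
    survival p f (n + 1) x d ≤ survival p f n x d := by
  rcases le_or_gt d 0 with hd | hd
  · simp [survival_of_nonpos _ _ hd]
  induction n generalizing x d with
  | zero =>
    have h := survival_le_one (f := f) hp 1 x d
    simpa [survival, hd] using h
  | succ n ih =>
    rw [survival_succ_of_pos _ _ hd, survival_succ_of_pos _ _ hd]
    refine Summable.tsum_le_tsum (fun y => mul_le_mul_of_nonneg_left ?_ (hp.nonneg _ _))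
      (summable_mul_survival hp (n + 1) x d) (summable_mul_survival hp n x d)
    rcases le_or_gt (d + f y) 0 with h | h
    · simp [survival_of_nonpos _ _ h]
    · exact ih _ _ h

theorem survival_mono (hp : IsStochastic p) (n : ℕ) (x : S) :
    Monotone (survival p f n x) := by
  induction n generalizing x with
  | zero =>
    intro d d' h
    simp only [survival]
    split_ifs with h1 h2
    · exact le_rfl
    · omega
    · exact zero_le_one
    · exact le_rfl
  | succ n ih =>
    intro d d' h
    rcases le_or_gt d 0 with hd | hd
    · rw [survival_of_nonpos _ _ hd]; exact survival_nonneg hp _ _ _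
    rw [survival_succ_of_pos _ _ hd, survival_succ_of_pos _ _ (hd.trans_le h)]
    exact Summable.tsum_le_tsum (fun y => mul_le_mul_of_nonneg_left
      (ih y (by omega)) (hp.nonneg _ _))
      (summable_mul_survival hp n x d) (summable_mul_survival hp n x d')

/-- The probability that all the sums `d + f Y₁ + … + f Yₖ`, `k ≥ 0`, are positive. -/
noncomputable def eternalSurvival (p : Matrix S S ℝ) (f : S → ℤ) (x : S) (d : ℤ) : ℝ :=
  ⨅ n, survival p f n x d

theorem tendsto_survival (hp : IsStochastic p) (x : S) (d : ℤ) :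
    Tendsto (fun n => survival p f n x d) atTop (𝓝 (eternalSurvival p f x d)) :=
  tendsto_atTop_ciInf (antitone_nat_of_succ_le fun n => survival_succ_le hp n x d)
    ⟨0, by rintro _ ⟨n, rfl⟩; exact survival_nonneg hp n x d⟩

theorem eternalSurvival_of_nonpos (x : S) {d : ℤ} (hd : d ≤ 0) :
    eternalSurvival p f x d = 0 := by
  simp [eternalSurvival, survival_of_nonpos _ _ hd]

theorem eternalSurvival_nonneg (hp : IsStochastic p) (x : S) (d : ℤ) :
    0 ≤ eternalSurvival p f x d :=
  ge_of_tendsto' (tendsto_survival hp x d) fun n => survival_nonneg hp n x d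

theorem eternalSurvival_le_one (hp : IsStochastic p) (x : S) (d : ℤ) :
    eternalSurvival p f x d ≤ 1 :=
  le_of_tendsto' (tendsto_survival hp x d) fun n => survival_le_one hp n x d

theorem abs_eternalSurvival_le_one (hp : IsStochastic p) (x : S) (d : ℤ) :
    |eternalSurvival p f x d| ≤ 1 := by
  rw [abs_of_nonneg (eternalSurvival_nonneg hp x d)]; exact eternalSurvival_le_one hp x d

theorem eternalSurvival_mono (hp : IsStochastic p) (x : S) :
    Monotone (eternalSurvival p f x) := fun d d' h =>
  le_of_tendsto_of_tendsto' (tendsto_survival hp x d) (tendsto_survival hp x d')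
    fun n => survival_mono hp n x h

theorem IsStochastic.tendsto_tsum_mul (hp : IsStochastic p) {ι : Type*} {l : Filter ι}
    {F : ι → S → ℝ} {G : S → ℝ} (hF : ∀ k y, |F k y| ≤ 1)
    (hlim : ∀ y, Tendsto (fun k => F k y) l (𝓝 (G y))) (x : S) :
    Tendsto (fun k => ∑' y, p x y * F k y) l (𝓝 (∑' y, p x y * G y)) := by
  refine tendsto_tsum_of_dominated_convergence (bound := p x) (hp.row_sum x).summable
    (fun y => (hlim y).const_mul _) (Eventually.of_forall fun k y => ?_)
  rw [norm_mul, Real.norm_of_nonneg (hp.nonneg x y)]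
  exact mul_le_of_le_one_right (hp.nonneg x y) (hF k y)

theorem eternalSurvival_of_pos (hp : IsStochastic p) (x : S) {d : ℤ} (hd : 0 < d) :
    eternalSurvival p f x d = ∑' y, p x y * eternalSurvival p f y (d + f y) := by
  refine tendsto_nhds_unique ((tendsto_survival hp x d).comp (tendsto_add_atTop_nat 1)) ?_
  simp only [Function.comp_def, survival_succ_of_pos _ _ hd]
  exact hp.tendsto_tsum_mul (F := fun n y => survival p f n y (d + f y))
    (fun n y => abs_survival_le_one hp n _ _) (fun y => tendsto_survival hp y _) x

theorem tendsto_eternalSurvival (hp : IsStochastic p) (x : S) :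
    Tendsto (eternalSurvival p f x) atTop (𝓝 (⨆ d, eternalSurvival p f x d)) :=
  tendsto_atTop_ciSup (eternalSurvival_mono hp x)
    ⟨1, by rintro _ ⟨d, rfl⟩; exact eternalSurvival_le_one hp x d⟩

/-- Each unit of `c` adds one telescoping sum over `d`, whose lower end vanishes. -/
theorem sum_range_sub_shift {W : ℤ → ℝ} (hW : ∀ d ≤ 0, W d = 0) (K c : ℕ) :
    ∑ d ∈ Finset.range K, (W ((d : ℤ) + 1) - W ((d : ℤ) + 1 - c)) =
      ∑ l ∈ Finset.range c, W ((K : ℤ) - l) := by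
  induction c with
  | zero => simp
  | succ c ih =>
    have h : ∑ d ∈ Finset.range K, (W (((d + 1 : ℕ) : ℤ) - c) - W ((d : ℤ) - c)) =
        W ((K : ℤ) - c) := by
      rw [Finset.sum_range_sub fun d : ℕ => W ((d : ℤ) - c), hW (((0 : ℕ) : ℤ) - c) (by simp),
        sub_zero]
    rw [Finset.sum_range_succ, ← ih, ← h, ← Finset.sum_add_distrib]
    refine Finset.sum_congr rfl fun d _ => ?_
    rw [show (d : ℤ) + 1 - ((c + 1 : ℕ) : ℤ) = d - c by push_cast; ring,
      show ((d + 1 : ℕ) : ℤ) - c = d + 1 - c by push_cast; ring]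
    ring

variable [DecidableEq S] {m : S → ℝ} {i : S} {c : S → ℕ}

/-- The charge of a state: `1` at `i` and `-c y` at the other states `y`. -/
def charge (i : S) (c : S → ℕ) (y : S) : ℤ := if y = i then 1 else -(c y : ℤ)

/-- If the charge is balanced with respect to the stationary measure, then its partial sums
starting from the state `i` almost surely do not stay positive. -/
theorem eternalSurvival_eq_zero (hp : IsStochastic p) (hirr : p.IsIrreducible)
    (hrec : IsRecurrent p) (hm : IsStationary p m) (hci : c i = 0)
    (hc : HasSum (fun y => m y * c y) (m i)) :
    eternalSurvival p (charge i c) i 1 = 0 := by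
  have : Nonempty S := ⟨i⟩
  set w := eternalSurvival p (charge i c) with hw
  set v : S → ℝ := fun x => ⨆ d, w x d with hvdef
  have hlim : ∀ x, Tendsto (w x) atTop (𝓝 (v x)) := fun x => tendsto_eternalSurvival hp x
  have hv1 : ∀ x, |v x| ≤ 1 := fun x =>
    le_of_tendsto' (hlim x).abs fun d => abs_eternalSurvival_le_one hp x d
  -- The shift of the level by the charge disappears in the limit `d → ∞`.
  have hvharm : ∀ x, ∑' y, p x y * v y = v x := by
    intro x
    refine tendsto_nhds_unique ?_ (hlim x)
    have h := hp.tendsto_tsum_mul (l := (atTop : Filter ℤ))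
      (F := fun d y => w y (d + charge i c y)) (G := v)
      (fun d y => abs_eternalSurvival_le_one hp y _)
      (fun y => (hlim y).comp (tendsto_atTop_add_const_right _ _ tendsto_id)) x
    refine h.congr' ?_
    filter_upwards [eventually_gt_atTop 0] with d hd
    exact (eternalSurvival_of_pos hp x hd).symm
  have hvi : ∀ x, v x = v i := eq_of_harmonic hp hirr hrec hv1 hvharm i
  -- The charge of `y` is included so that averaging over one step removes it, by
  -- `eternalSurvival_of_pos`. The drift of `φ K` then compares two shifted sums of `w y` and
  -- telescopes.
  let φ : ℕ → S → ℝ := fun K y => ∑ d ∈ Finset.range K, w y ((d : ℤ) + 1 + charge i c y)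
  have hφ : ∀ K y, |φ K y| ≤ K := fun K y => by
    refine (Finset.abs_sum_le_sum_abs _ _).trans ?_
    refine (Finset.sum_le_card_nsmul _ _ 1 fun d _ => abs_eternalSurvival_le_one hp y _).trans ?_
    simp
  have hpφ : ∀ K x, ∑' y, p x y * φ K y = ∑ d ∈ Finset.range K, w x ((d : ℤ) + 1) := by
    intro K x
    simp only [φ, Finset.mul_sum]
    rw [Summable.tsum_finsetSum fun d _ =>
      hp.summable_mul (fun y => abs_eternalSurvival_le_one hp y _) x]
    exact Finset.sum_congr rfl fun d _ => (eternalSurvival_of_pos hp x (by omega)).symm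
  have hψ : ∀ K y, ∑' z, p y z * φ K z - φ K y =
      ∑ l ∈ Finset.range (c y), w y ((K : ℤ) - l) +
        if y = i then w i 1 - w i ((K : ℤ) + 1) else 0 := by
    intro K y
    rw [hpφ, ← Finset.sum_sub_distrib]
    by_cases hy : y = i
    · subst hy
      have h := Finset.sum_range_sub' (fun d : ℕ => w y ((d : ℤ) + 1)) K
      simpa [charge, hci] using h
    · simp only [charge, hy, if_false, add_zero]
      exact sum_range_sub_shift (fun d hd => eternalSurvival_of_nonpos y hd) K (c y)
  -- Although `φ K` grows with `K`, its drift has a bound independent of `K` that is summable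
  -- against `m`.
  have hbound : ∀ K y, ‖m y * (∑' z, p y z * φ K z - φ K y)‖ ≤
      m y * c y + if y = i then m i else 0 := by
    intro K y
    rw [norm_mul, Real.norm_of_nonneg (hm.pos y).le, hψ]
    have h1 : ‖∑ l ∈ Finset.range (c y), w y ((K : ℤ) - l)‖ ≤ c y := by
      refine (norm_sum_le_of_le (n := fun _ => (1 : ℝ)) _ fun d _ => ?_).trans (by simp)
      exact abs_eternalSurvival_le_one hp y _
    have h2 : ‖if y = i then w i 1 - w i ((K : ℤ) + 1) else 0‖ ≤ if y = i then 1 else 0 := by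
      split_ifs
      · exact abs_sub_le_of_nonneg_of_le (eternalSurvival_nonneg hp _ _)
          (eternalSurvival_le_one hp _ _) (eternalSurvival_nonneg hp _ _)
          (eternalSurvival_le_one hp _ _)
      · simp
    calc _ ≤ m y * (c y + if y = i then 1 else 0) :=
          mul_le_mul_of_nonneg_left ((norm_add_le _ _).trans (add_le_add h1 h2)) (hm.pos y).le
      _ = _ := by
          rw [mul_add]; congr 1
          by_cases hy : y = i <;> simp [hy]
  have hbs : Summable fun y => m y * (c y : ℝ) + if y = i then m i else 0 :=
    hc.summable.add (summable_of_ne_finset_zero (s := {i}) fun y hy => by simp_all)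
  have hzero : ∀ K, ∑' y, m y * (∑' z, p y z * φ K z - φ K y) = 0 := fun K => by
    refine tsum_stationary_mul_sub_eq_zero hp hirr hrec hm (hφ K) ?_
    refine Summable.of_nonneg_of_le (fun y => mul_nonneg (hm.pos y).le (abs_nonneg _))
      (fun y => ?_) hbs
    refine le_trans (le_of_eq ?_) (hbound K y)
    rw [norm_mul, Real.norm_of_nonneg (hm.pos y).le, Real.norm_eq_abs]
  have hconv : ∀ (y : S) (a : ℤ), Tendsto (fun K : ℕ => w y ((K : ℤ) + a)) atTop (𝓝 (v y)) :=
    fun y a => (hlim y).comp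
      (tendsto_atTop_add_const_right _ _ tendsto_natCast_atTop_atTop)
  have hlimit : Tendsto (fun K => ∑' y, m y * (∑' z, p y z * φ K z - φ K y)) atTop
      (𝓝 (∑' y, m y * (c y * v i + if y = i then w i 1 - v i else 0))) := by
    refine tendsto_tsum_of_dominated_convergence hbs (fun y => ?_)
      (Eventually.of_forall hbound)
    refine Tendsto.const_mul _ ?_
    simp_rw [hψ]
    refine Tendsto.add ?_ ?_
    · have h : Tendsto (fun K : ℕ => ∑ l ∈ Finset.range (c y), w y ((K : ℤ) - l)) atTop
          (𝓝 (∑ l ∈ Finset.range (c y), v y)) :=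
        tendsto_finsetSum _ fun l _ => hconv y (-l)
      simpa [hvi y] using h
    · split_ifs
      · exact (hconv i 1).const_sub _
      · exact tendsto_const_nhds
  simp_rw [hzero] at hlimit
  have h0 := tendsto_nhds_unique hlimit tendsto_const_nhds
  have h1 : HasSum (fun y => m y * (c y * v i + if y = i then w i 1 - v i else 0))
      (m i * v i + m i * (w i 1 - v i)) := by
    have h2 : HasSum (fun y => if y = i then m i * (w i 1 - v i) else 0)
        (m i * (w i 1 - v i)) := by
      simpa using hasSum_ite_eq i (m i * (w i 1 - v i))
    have h3 := (hc.mul_right (v i)).add h2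
    refine (funext fun y => ?_ : (fun y => m y * (c y * v i + if y = i then w i 1 - v i else 0)) = _) ▸ h3
    by_cases hy : y = i
    · simp [hy, mul_add, mul_assoc]
    · simp [hy, mul_assoc]
  rw [h1.tsum_eq] at h0
  -- The balance of charges cancels the terms with `v i`.
  have h4 : m i * w i 1 = 0 := by linarith
  exact (mul_eq_zero.1 h4).resolve_left (hm.pos i).ne'

end Survival

/-! ### Path weights of the stationary chain and the matching count. -/

section Paths

open Filter Topology
open scoped ENNReal

variable {S : Type*} {p : Matrix S S ℝ} {m : S → ℝ}

theorem ofNat_succ_of_le {n l : ℕ} (h : l ≤ n) :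
    Fin.ofNat (n + 2) (l + 1) = (Fin.ofNat (n + 1) l).succ := by
  ext
  simp [Nat.mod_eq_of_lt (show l < n + 1 by omega), Nat.mod_eq_of_lt (show l + 1 < n + 2 by omega)]

/-- The product of the transition probabilities along a path. -/
noncomputable def transitionWeight (p : Matrix S S ℝ) {n : ℕ} (z : Fin (n + 1) → S) : ℝ≥0∞ :=
  ∏ k : Fin n, ENNReal.ofReal (p (z k.castSucc) (z k.succ))

theorem transitionWeight_cons {n : ℕ} (y : S) (z : Fin (n + 1) → S) :
    transitionWeight p (Fin.cons y z : Fin (n + 2) → S) =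
      ENNReal.ofReal (p y (z 0)) * transitionWeight p z := by
  simp only [transitionWeight, Fin.prod_univ_succ (n := n), Fin.castSucc_zero, Fin.cons_zero,
    Fin.cons_succ, ← Fin.succ_castSucc]

theorem tsum_path_cons {n : ℕ} (F : (Fin (n + 2) → S) → ℝ≥0∞) :
    ∑' z, F z = ∑' (y : S) (z : Fin (n + 1) → S), F (Fin.cons y z) := by
  rw [← (Fin.consEquiv fun _ : Fin (n + 2) => S).tsum_eq F, ENNReal.tsum_prod']
  rfl

theorem tsum_path_one (F : (Fin 1 → S) → ℝ≥0∞) : ∑' z, F z = ∑' y : S, F fun _ => y :=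
  ((Equiv.funUnique (Fin 1) S).symm.tsum_eq F).symm

theorem IsStochastic.tsum_ofReal (hp : IsStochastic p) (x : S) :
    ∑' y, ENNReal.ofReal (p x y) = 1 := by
  rw [← ENNReal.ofReal_tsum_of_nonneg (hp.nonneg x) (hp.row_sum x).summable,
    (hp.row_sum x).tsum_eq, ENNReal.ofReal_one]

theorem IsStochastic.tsum_mul_transitionWeight (hp : IsStochastic p) (n : ℕ) (g : S → ℝ≥0∞) :
    ∑' z : Fin (n + 1) → S, g (z 0) * transitionWeight p z = ∑' y, g y := by
  induction n generalizing g with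
  | zero => simp [tsum_path_one, transitionWeight]
  | succ n ih =>
    rw [tsum_path_cons]
    refine tsum_congr fun y => ?_
    simp only [Fin.cons_zero, transitionWeight_cons, ENNReal.tsum_mul_left]
    rw [ih fun u => ENNReal.ofReal (p y u), hp.tsum_ofReal, mul_one]

-- The sums in the condition include the charge of the initial state, which `survival` does not
-- count; hence the level `d + f y`. The induction peels off the first state.
open Classical in
theorem tsum_mul_transitionWeight_survival (hp : IsStochastic p) (f : S → ℤ) (n : ℕ)
    (g : S → ℝ≥0∞) (d : ℤ) :
    ∑' z : Fin (n + 1) → S, (if ∀ k ≤ n,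
        0 < d + ∑ l ∈ Finset.range (k + 1), f (z (Fin.ofNat (n + 1) l)) then
        g (z 0) * transitionWeight p z else 0) =
      ∑' y, g y * ENNReal.ofReal (survival p f n y (d + f y)) := by
  induction n generalizing g d with
  | zero =>
    rw [tsum_path_one]
    refine tsum_congr fun y => ?_
    by_cases h : 0 < d + f y <;> simp [transitionWeight, survival, h]
  | succ n ih =>
    rw [tsum_path_cons]
    refine tsum_congr fun y => ?_
    have hcond : ∀ z : Fin (n + 1) → S,
        (∀ k ≤ n + 1, 0 < d + ∑ l ∈ Finset.range (k + 1),
          f ((Fin.cons y z : Fin (n + 2) → S) (Fin.ofNat (n + 2) l))) ↔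
        0 < d + f y ∧ ∀ k ≤ n, 0 < d + f y +
          ∑ l ∈ Finset.range (k + 1), f (z (Fin.ofNat (n + 1) l)) := by
      intro z
      have hk : ∀ k ≤ n + 1, d + ∑ l ∈ Finset.range (k + 1),
          f ((Fin.cons y z : Fin (n + 2) → S) (Fin.ofNat (n + 2) l)) =
          d + f y + ∑ l ∈ Finset.range k, f (z (Fin.ofNat (n + 1) l)) := by
        intro k hk
        rw [Finset.sum_range_succ', add_assoc, add_comm (f y)]
        congr 2
        refine Finset.sum_congr rfl fun l hl => ?_
        rw [ofNat_succ_of_le (by have := Finset.mem_range.1 hl; omega), Fin.cons_succ]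
      constructor
      · intro h
        have h0 := h 0 (by omega)
        rw [hk 0 (by omega)] at h0
        refine ⟨by simpa using h0, fun k hkn => ?_⟩
        rw [← hk (k + 1) (by omega)]
        exact h (k + 1) (by omega)
      · rintro ⟨h0, h⟩ k hkn
        rw [hk k hkn]
        cases k with
        | zero => simpa using h0
        | succ k => exact h k (by omega)
    simp only [hcond, Fin.cons_zero, transitionWeight_cons]
    by_cases h0 : 0 < d + f y
    · simp only [h0, true_and, ← mul_ite_zero (_ : Prop) (g y), ENNReal.tsum_mul_left]
      have h := ih (fun u => ENNReal.ofReal (p y u)) (d + f y)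
      rw [h, survival_succ_of_pos _ _ h0, ENNReal.ofReal_tsum_of_nonneg
        (fun u => mul_nonneg (hp.nonneg _ _) (survival_nonneg hp _ _ _))
        (summable_mul_survival hp n y (d + f y))]
      simp_rw [ENNReal.ofReal_mul (hp.nonneg y _)]
    · simp [h0, survival_of_nonpos _ _ (not_lt.1 h0)]

/-- The weight of a path under the stationary two-sided chain. -/
noncomputable def pathWeight (p : Matrix S S ℝ) (m : S → ℝ) {n : ℕ} (z : Fin (n + 1) → S) :
    ℝ≥0∞ :=
  ENNReal.ofReal (m (z 0)) * transitionWeight p z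

theorem tsum_pathWeight_cons (hp : IsStochastic p) (hm : IsStationary p m) {n : ℕ}
    (z : Fin (n + 1) → S) :
    ∑' y, pathWeight p m (Fin.cons y z : Fin (n + 2) → S) = pathWeight p m z := by
  simp only [pathWeight, transitionWeight_cons, Fin.cons_zero, ← mul_assoc,
    ENNReal.tsum_mul_right, ← ENNReal.ofReal_mul (hm.pos _).le]
  rw [← ENNReal.ofReal_tsum_of_nonneg (fun y => mul_nonneg (hm.pos y).le (hp.nonneg _ _))
    (hm.stationary _).summable, (hm.stationary _).tsum_eq]

/-- Shift invariance of the path weights: by stationarity, `e` extra states on the left can be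
summed out. -/
theorem tsum_mul_pathWeight (hp : IsStochastic p) (hm : IsStationary p m) {L : ℕ} (e n : ℕ)
    (hn : n = e + L) (G : (Fin (L + 1) → S) → ℝ≥0∞) :
    ∑' z : Fin (n + 1) → S, G (fun r => z (Fin.ofNat (n + 1) (e + r))) * pathWeight p m z =
      ∑' z : Fin (L + 1) → S, G z * pathWeight p m z := by
  induction e generalizing n with
  | zero =>
    obtain rfl : n = L := by omega
    simp
  | succ e ih =>
    obtain rfl : n = (e + L) + 1 := by omega
    rw [tsum_path_cons, ENNReal.tsum_comm, ← ih (e + L) rfl]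
    refine tsum_congr fun z => ?_
    rw [← tsum_pathWeight_cons hp hm z, ← ENNReal.tsum_mul_left]
    refine tsum_congr fun y => ?_
    congr 2
    funext r
    rw [show e + 1 + (r : ℕ) = e + r + 1 by ring, ofNat_succ_of_le (by omega), Fin.cons_succ]

theorem prod_dual (hm : IsStationary p m) (a : ℕ) (x : ℤ → S) :
    m (x 0) * ∏ k ∈ Finset.range a, dual p m (x (-(k : ℤ))) (x (-(k : ℤ) - 1)) =
      m (x (-(a : ℤ))) * ∏ k ∈ Finset.range a, p (x ((k : ℤ) - a)) (x ((k : ℤ) - a + 1)) := by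
  induction a with
  | zero => simp
  | succ a ih =>
    rw [Finset.prod_range_succ, ← mul_assoc, ih, Finset.prod_range_succ']
    simp only [dual]
    rw [show -((a + 1 : ℕ) : ℤ) = -(a : ℤ) - 1 by push_cast; ring,
      show ((0 : ℕ) : ℤ) - ((a + 1 : ℕ) : ℤ) = -(a : ℤ) - 1 by push_cast; ring,
      show -(a : ℤ) - 1 + 1 = -(a : ℤ) by ring]
    have h : ∀ k : ℕ, ((k + 1 : ℕ) : ℤ) - ((a + 1 : ℕ) : ℤ) = k - a := fun k => by push_cast; ring
    simp only [h]
    have := (hm.pos (x (-(a : ℤ)))).ne'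
    field_simp

/-- Reversing the backward chain telescopes the ratios of `m`. The chain with initial law `μ` thus
has density `μ / m`, evaluated at time `0`, with respect to the stationary path weights. -/
theorem cylinder_weight_eq (hm : IsStationary p m) (μ : S → ℝ) (a b : ℕ) (x : ℤ → S) :
    μ (x 0) * (∏ k ∈ Finset.range b, p (x (k : ℤ)) (x ((k : ℤ) + 1))) *
        ∏ k ∈ Finset.range a, dual p m (x (-(k : ℤ))) (x (-(k : ℤ) - 1)) =
      μ (x 0) / m (x 0) * (m (x (-(a : ℤ))) *
        ∏ k ∈ Finset.range (a + b), p (x ((k : ℤ) - a)) (x ((k : ℤ) - a + 1))) := by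
  have h0 := (hm.pos (x 0)).ne'
  rw [Finset.prod_range_add, ← mul_assoc (m _), ← prod_dual hm]
  have h : ∀ k : ℕ, ((a + k : ℕ) : ℤ) - a = k := fun k => by push_cast; ring
  simp only [h]
  field_simp

theorem pathWeight_eq_ofReal (hp : IsStochastic p) (hm : IsStationary p m) (a b : ℕ) (x : ℤ → S) :
    pathWeight p m (fun r : Fin (a + b + 1) => x ((r : ℕ) - (a : ℤ))) =
      ENNReal.ofReal (m (x (-(a : ℤ))) *
        ∏ k ∈ Finset.range (a + b), p (x ((k : ℤ) - a)) (x ((k : ℤ) - a + 1))) := by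
  rw [ENNReal.ofReal_mul (hm.pos _).le,
    ENNReal.ofReal_prod_of_nonneg fun _ _ => hp.nonneg _ _, ← Fin.prod_univ_eq_prod_range
      (fun k : ℕ => ENNReal.ofReal (p (x ((k : ℤ) - a)) (x ((k : ℤ) - a + 1)))) (a + b)]
  simp only [pathWeight, transitionWeight, Fin.val_zero, Fin.val_castSucc, Fin.val_succ]
  congr 1
  · simp
  · refine Finset.prod_congr rfl fun (k : Fin (a + b)) _ => ?_
    rw [show (((k : ℕ) + 1 : ℕ) : ℤ) - a = (k : ℕ) - (a : ℤ) + 1 by push_cast; ring]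

/-- The law of a two-sided chain on a time window is given by the path weights. -/
theorem IsTwoSidedMarkovChain.measure_window {Ω : Type*} [MeasurableSpace S] [MeasurableSpace Ω]
    (hp : IsStochastic p) (hm : IsStationary p m) {μ : S → ℝ} (hμ : ∀ x, 0 ≤ μ x)
    {X : ℤ → Ω → S} {P : Measure Ω} [IsProbabilityMeasure P]
    (hX : IsTwoSidedMarkovChain p m μ X P) {s L : ℕ} (hs : s ≤ L) (z : Fin (L + 1) → S) :
    P {ω | (fun r : Fin (L + 1) => X ((r : ℕ) - (s : ℤ)) ω) = z} =
      ENNReal.ofReal (μ (z (Fin.ofNat (L + 1) s)) / m (z (Fin.ofNat (L + 1) s))) *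
        pathWeight p m z := by
  obtain ⟨b, rfl⟩ := Nat.exists_eq_add_of_le hs
  let x : ℤ → S := fun k => z (Fin.ofNat (s + b + 1) (k + s).toNat)
  have hx : ∀ r : Fin (s + b + 1), x ((r : ℕ) - (s : ℤ)) = z r := fun r => by simp [x]
  have hz : z = fun r : Fin (s + b + 1) => x ((r : ℕ) - (s : ℤ)) := funext fun r => (hx r).symm
  have hx0 : z (Fin.ofNat (s + b + 1) s) = x 0 := by simp [x]
  have hset : {ω | (fun r : Fin (s + b + 1) => X ((r : ℕ) - (s : ℤ)) ω) = z} =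
      {ω | ∀ k : ℤ, -(s : ℤ) ≤ k → k ≤ (b : ℤ) → X k ω = x k} := by
    ext ω
    simp only [Set.mem_ofPred_eq, funext_iff]
    constructor
    · intro h k h1 h2
      have h3 := h ⟨(k + s).toNat, by omega⟩
      rw [← hx] at h3
      rwa [show (((⟨(k + s).toNat, by omega⟩ : Fin (s + b + 1)) : ℕ) : ℤ) - s = k by
        simp only []; omega] at h3
    · intro h r
      rw [← hx]
      exact h _ (by omega) (by omega)
  have hc := hX.cylinder s b x
  rw [cylinder_weight_eq hm] at hc
  rw [hset, hx0, ← ofReal_measureReal, hc, ENNReal.ofReal_mul (div_nonneg (hμ _) (hm.pos _).le),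
    ← pathWeight_eq_ofReal hp hm, ← hz]

theorem measure_preimage_eq_tsum {Ω α : Type*} [MeasurableSpace Ω] [MeasurableSpace α]
    [Countable α] [MeasurableSingletonClass α] (P : Measure Ω) {Y : Ω → α} (hY : Measurable Y)
    (A : Set α) [DecidablePred (· ∈ A)] :
    P {ω | Y ω ∈ A} = ∑' z, if z ∈ A then P {ω | Y ω = z} else 0 := by
  have h := (P.map Y).tsum_indicator_apply_singleton A A.to_countable.measurableSet
  rw [Measure.map_apply hY A.to_countable.measurableSet] at h
  change P (Y ⁻¹' A) = _
  rw [← h]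
  refine tsum_congr fun z => ?_
  rw [Set.indicator_apply, Measure.map_apply hY (measurableSet_singleton z)]
  rfl

/-- In a sequence of integers ending with `g M`, at most `-g M` positive starting points see their
partial sums become nonpositive for the first time at `M`. -/
theorem card_filter_first_nonpos_le (g : ℕ → ℤ) (M : ℕ) :
    ((Finset.range (M + 1)).filter fun n => 0 < g (M - n) ∧
      (∀ k < n, 0 < ∑ l ∈ Finset.range (k + 1), g (M - n + l)) ∧
        ∑ l ∈ Finset.range (n + 1), g (M - n + l) ≤ 0).card ≤ (-g M).toNat := by
  have hcard : (Finset.Icc 1 (-g M)).card = (-g M).toNat := by simp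
  rw [← hcard]
  -- Send a starting point to its level just before `M`: this is positive, and at most `-g M` since
  -- adding `g M` makes it nonpositive.
  refine Finset.card_le_card_of_injOn (fun n => ∑ l ∈ Finset.range n, g (M - n + l)) ?_ ?_
  · intro n hn
    simp only [Finset.coe_filter, Finset.mem_range, Set.mem_ofPred_eq] at hn
    obtain ⟨hnM, h0, h1, h2⟩ := hn
    rw [Finset.sum_range_succ, show M - n + n = M by omega] at h2
    have hn0 : n ≠ 0 := by
      rintro rfl
      simp at h0 h2
      omega
    have h3 := h1 (n - 1) (by omega)
    rw [show n - 1 + 1 = n by omega] at h3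
    simp only [Finset.coe_Icc, Set.mem_Icc]
    omega
  -- The earlier start `M - n'` has accumulated a positive sum before reaching `M - n`, so its level
  -- before `M` is strictly higher.
  · have key : ∀ n n', n < n' → n' ≤ M →
        (∀ k < n', 0 < ∑ l ∈ Finset.range (k + 1), g (M - n' + l)) →
        ∑ l ∈ Finset.range n, g (M - n + l) < ∑ l ∈ Finset.range n', g (M - n' + l) := by
      intro n n' hlt hle h
      obtain ⟨j, rfl⟩ := Nat.exists_eq_add_of_lt hlt
      rw [show n + j + 1 = (j + 1) + n by ring, Finset.sum_range_add]
      have h1 := h j (by omega)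
      have h2 : ∀ l, M - (j + 1 + n) + (j + 1 + l) = M - n + l := fun l => by omega
      simp only [h2]
      rw [show n + j + 1 = (j + 1) + n by ring] at h1
      omega
    intro n hn n' hn' heq
    simp only [Finset.coe_filter, Finset.mem_range, Set.mem_ofPred_eq] at hn hn' heq
    rcases lt_trichotomy n n' with h | h | h
    · exact absurd heq (key n n' h (by omega) hn'.2.2.1).ne
    · exact h
    · exact absurd heq (key n' n h (by omega) hn.2.2.1).ne'

end Paths

/-! ### `T_*` as a hitting time of the accumulated charge, and its measurability. -/

section Embedding

open Filter Topology
open scoped ENNReal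

variable {S : Type*} [DecidableEq S] {p : Matrix S S ℝ} {m ν : S → ℝ} {i : S} {c : S → ℕ}

theorem charge_self (i : S) (c : S → ℕ) : charge i c i = 1 := by simp [charge]

theorem toNat_neg_charge (hci : c i = 0) (y : S) : (-charge i c y).toNat = c y := by
  by_cases h : y = i <;> simp [charge, h, hci]

/-- The accumulated charge of a trajectory on the times `0, …, n`. -/
def chargeSum (i : S) (c : S → ℕ) (w : ℤ → S) (n : ℕ) : ℤ :=
  ∑ k ∈ Finset.range (n + 1), charge i c (w k)

theorem localTime_eq_sum (m : S → ℝ) (w : ℤ → S) (j : S) (n : ℕ) :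
    localTime m w j (Finset.Icc 0 (n : ℤ)) =
      ∑ k ∈ Finset.range (n + 1), if j = w k then 1 / m j else 0 := by
  have himg : Finset.Icc 0 (n : ℤ) = (Finset.range (n + 1)).map Nat.castEmbedding := by
    ext k
    simp only [Finset.mem_Icc, Finset.mem_map, Finset.mem_range, Nat.castEmbedding_apply]
    exact ⟨fun h => ⟨k.toNat, by omega, by omega⟩, by rintro ⟨l, h, rfl⟩; omega⟩
  rw [localTime, himg, Finset.filter_map, Finset.card_map, Finset.card_filter, Nat.cast_sum,
    Finset.sum_div]
  refine Finset.sum_congr rfl fun k _ => ?_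
  by_cases h : j = w k
  · simp [← h]
  · simp [h, Ne.symm h]

/-- Multiplied by `m i`, the difference of the two local times is the accumulated charge. -/
theorem localTime_le_iff (hm : ∀ j, 0 < m j) (hci : c i = 0)
    (hc : ∀ j, m i / m j * ν j = c j) (w : ℤ → S) (n : ℕ) :
    localTime m w i (Finset.Icc 0 (n : ℤ)) ≤
      ∑' j, ν j * localTime m w j (Finset.Icc 0 (n : ℤ)) ↔ chargeSum i c w n ≤ 0 := by
  have hi := (hm i).ne'
  have h1 : ∑' j, ν j * localTime m w j (Finset.Icc 0 (n : ℤ)) =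
      ∑ k ∈ Finset.range (n + 1), ν (w k) / m (w k) := by
    have h : HasSum (fun j => ∑ k ∈ Finset.range (n + 1), if j = w k then ν (w k) / m (w k) else 0)
        (∑ k ∈ Finset.range (n + 1), ν (w k) / m (w k)) :=
      hasSum_sum fun k _ => hasSum_ite_eq (w k) (ν (w k) / m (w k))
    rw [← h.tsum_eq]
    refine tsum_congr fun j => ?_
    rw [localTime_eq_sum, Finset.mul_sum]
    refine Finset.sum_congr rfl fun k _ => ?_
    split_ifs with hj
    · rw [← hj]; ring
    · simp
  have h2 : m i * (localTime m w i (Finset.Icc 0 (n : ℤ)) -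
      ∑' j, ν j * localTime m w j (Finset.Icc 0 (n : ℤ))) = (chargeSum i c w n : ℝ) := by
    rw [h1, localTime_eq_sum, ← Finset.sum_sub_distrib, Finset.mul_sum, chargeSum, Int.cast_sum]
    refine Finset.sum_congr rfl fun k _ => ?_
    have hk : m i * (ν (w k) / m (w k)) = c (w k) := by rw [← hc]; ring
    rw [mul_sub, hk, charge]
    by_cases h : i = w k
    · rw [← h]; simp [hci, hi]
    · simp [h, Ne.symm h]
  rw [← sub_nonpos, ← Int.cast_nonpos (R := ℝ), ← h2]
  exact ⟨fun h => mul_nonpos_of_nonneg_of_nonpos (hm i).le h,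
    fun h => nonpos_of_mul_nonpos_right h (hm i)⟩

theorem sInf_coe_le_iff (Q : ℕ → Prop) (n : ℕ) :
    sInf {t : ℕ∞ | ∃ k : ℕ, t = k ∧ Q k} ≤ n ↔ ∃ k ≤ n, Q k := by
  constructor
  · intro h
    by_contra! hn
    have h1 : ((n + 1 : ℕ) : ℕ∞) ≤ sInf {t : ℕ∞ | ∃ k : ℕ, t = k ∧ Q k} := by
      refine le_sInf ?_
      rintro t ⟨k, rfl, hk⟩
      refine Nat.cast_le.2 ?_
      by_contra! hlt
      exact hn k (by omega) hk
    have h2 := Nat.cast_le.1 (h1.trans h)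
    omega
  · rintro ⟨k, hk, hQ⟩
    have h : (k : ℕ∞) ∈ {t : ℕ∞ | ∃ k : ℕ, t = k ∧ Q k} := ⟨k, rfl, hQ⟩
    exact (sInf_le h).trans (Nat.cast_le.2 hk)

theorem Tstar_le_iff (hm : ∀ j, 0 < m j) (hci : c i = 0)
    (hc : ∀ j, m i / m j * ν j = c j) (w : ℤ → S) (n : ℕ) :
    Tstar m ν i w ≤ n ↔ ∃ k ≤ n, chargeSum i c w k ≤ 0 := by
  rw [Tstar, sInf_coe_le_iff]
  simp only [localTime_le_iff hm hci hc]

theorem Tstar_eq_coe_iff (hm : ∀ j, 0 < m j) (hci : c i = 0)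
    (hc : ∀ j, m i / m j * ν j = c j) (w : ℤ → S) (n : ℕ) :
    Tstar m ν i w = n ↔ (∀ k < n, 0 < chargeSum i c w k) ∧ chargeSum i c w n ≤ 0 := by
  have hle := Tstar_le_iff hm hci hc w
  constructor
  · intro h
    have hlt : ∀ k < n, 0 < chargeSum i c w k := by
      intro k hk
      by_contra! h0
      have h1 := (hle k).2 ⟨k, le_rfl, h0⟩
      rw [h, Nat.cast_le] at h1
      omega
    obtain ⟨k, hk, h0⟩ := (hle n).1 h.le
    rcases hk.lt_or_eq with hk | rfl
    · exact absurd h0 (hlt k hk).not_ge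
    · exact ⟨hlt, h0⟩
  · rintro ⟨h1, h2⟩
    refine le_antisymm ((hle n).2 ⟨n, le_rfl, h2⟩) ?_
    by_contra! hlt
    obtain ⟨k, hk⟩ := ENat.ne_top_iff_exists.1 hlt.ne_top
    rw [← hk, Nat.cast_lt] at hlt
    obtain ⟨l, hl, h3⟩ := (hle k).1 hk.ge
    exact absurd h3 (h1 l (by omega)).not_ge

theorem pos_chargeSum_of_Tstar_eq_top (hm : ∀ j, 0 < m j) (hci : c i = 0)
    (hc : ∀ j, m i / m j * ν j = c j) {w : ℤ → S} (h : Tstar m ν i w = ⊤) (k : ℕ) :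
    0 < chargeSum i c w k := by
  by_contra! h0
  have h1 := (Tstar_le_iff hm hci hc w k).2 ⟨k, le_rfl, h0⟩
  simp [h] at h1

section Measurability

variable [MeasurableSpace S] [DiscreteMeasurableSpace S]

theorem measurable_Tstar (hm : ∀ j, 0 < m j) (hci : c i = 0)
    (hc : ∀ j, m i / m j * ν j = c j) : Measurable (Tstar m ν i) := by
  have hcs : ∀ n, Measurable fun w : ℤ → S => chargeSum i c w n := fun n =>
    Finset.measurable_fun_sum _ fun k _ =>
      (Measurable.of_discrete (f := charge i c)).comp (measurable_pi_apply (k : ℤ))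
  have hcoe : ∀ n : ℕ, MeasurableSet (Tstar m ν i ⁻¹' {(n : ℕ∞)}) := by
    intro n
    have : Tstar m ν i ⁻¹' {(n : ℕ∞)} =
        (⋂ k : ℕ, ⋂ _ : k < n, {w | 0 < chargeSum i c w k}) ∩ {w | chargeSum i c w n ≤ 0} := by
      ext w
      simp [Tstar_eq_coe_iff hm hci hc w n]
    rw [this]
    exact (MeasurableSet.iInter fun k => MeasurableSet.iInter fun _ =>
      hcs k measurableSet_Ioi).inter (hcs n measurableSet_Iic)
  refine measurable_to_countable' fun t => ?_
  induction t using ENat.recTopCoe with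
  | top =>
    have : Tstar m ν i ⁻¹' {⊤} = (⋃ n : ℕ, Tstar m ν i ⁻¹' {(n : ℕ∞)})ᶜ := by
      ext w
      simp only [Set.mem_preimage, Set.mem_singleton_iff, Set.mem_compl_iff, Set.mem_iUnion,
        not_exists]
      constructor
      · intro h n; simp [h]
      · intro h
        by_contra hne
        obtain ⟨k, hk⟩ := ENat.ne_top_iff_exists.1 hne
        exact h k hk.symm
    rw [this]
    exact (MeasurableSet.iUnion hcoe).compl
  | coe n => exact hcoe n

variable {Ω : Type*} [MeasurableSpace Ω] {X : ℤ → Ω → S}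

theorem isStoppingTime_Tstar (hm : ∀ j, 0 < m j) (hci : c i = 0)
    (hc : ∀ j, m i / m j * ν j = c j) (hX : ∀ n, Measurable (X n)) :
    IsStoppingTime (forwardFiltration X hX) fun ω => Tstar m ν i fun n => X n ω := by
  intro n
  have hset : {ω | Tstar m ν i (fun n => X n ω) ≤ (n : ℕ∞)} =
      ⋃ k : ℕ, ⋃ _ : k ≤ n, {ω | chargeSum i c (fun n => X n ω) k ≤ 0} := by
    ext ω
    simp only [Set.mem_ofPred_eq, Set.mem_iUnion, Tstar_le_iff hm hci hc, exists_prop]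
  change MeasurableSet[forwardFiltration X hX n] {ω | Tstar m ν i (fun n => X n ω) ≤ (n : ℕ∞)}
  rw [hset]
  refine MeasurableSet.iUnion fun k => MeasurableSet.iUnion fun hk => ?_
  have hXl : ∀ l ≤ n, Measurable[forwardFiltration X hX n] (X l) := fun l hl =>
    Measurable.mono (comap_measurable (X l))
      (le_iSup₂ (f := fun (k : ℕ) (_ : k ≤ n) => MeasurableSpace.comap (X k) inferInstance) l hl)
      le_rfl
  have hmeas : Measurable[forwardFiltration X hX n] fun ω => chargeSum i c (fun n => X n ω) k :=
    Finset.measurable_fun_sum _ fun l hl =>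
      (Measurable.of_discrete (f := charge i c)).comp
        (hXl l (by have := Finset.mem_range.1 hl; omega))
  exact hmeas measurableSet_Iic

end Measurability

end Embedding

/-! ### Almost sure finiteness of `T_*` and the law of the shifted process. -/

section Main

open Filter Topology
open scoped ENNReal

variable {S : Type*} [DecidableEq S] {p : Matrix S S ℝ} {m ν : S → ℝ} {i : S} {c : S → ℕ}

theorem single_nonneg (i x : S) : (0 : ℝ) ≤ (Pi.single i 1 : S → ℝ) x := by
  rw [Pi.single_apply]; split_ifs <;> simp

theorem measurable_window {S Ω : Type*} [MeasurableSpace S] [MeasurableSpace Ω]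
    {X : ℤ → Ω → S} (hX : ∀ n, Measurable (X n)) (L s : ℕ) :
    Measurable fun ω => fun r : Fin (L + 1) => X ((r : ℕ) - (s : ℤ)) ω :=
  measurable_pi_lambda _ fun _ => hX _

theorem eq_of_le_of_tsum_eq_one {α : Type*} {u v : α → ℝ≥0∞} (hle : ∀ z, u z ≤ v z)
    (hu : ∑' z, u z = 1) (hv : ∑' z, v z = 1) (z : α) : u z = v z := by
  by_contra hne
  have h := ENNReal.tsum_lt_tsum (by simp [hu]) hle (lt_of_le_of_ne (hle z) hne)
  rw [hu, hv] at h
  exact h.false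

theorem tsum_window_weight {S : Type*} {p : Matrix S S ℝ} {m ν : S → ℝ} (hp : IsStochastic p)
    (hm : IsStationary p m) (hν : IsProbability ν) (a b : ℕ) : ∑' x : Fin (a + b + 1) → S,
      ENNReal.ofReal (ν (x (Fin.ofNat (a + b + 1) a)) / m (x (Fin.ofNat (a + b + 1) a))) *
        pathWeight p m x = 1 := by
  have h := tsum_mul_pathWeight hp hm (L := b) a (a + b) rfl
    (fun z => ENNReal.ofReal (ν (z 0) / m (z 0)))
  simp only [Fin.val_zero, add_zero] at h
  rw [h]
  have h2 : ∀ z : Fin (b + 1) → S, ENNReal.ofReal (ν (z 0) / m (z 0)) * pathWeight p m z =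
      ENNReal.ofReal (ν (z 0)) * transitionWeight p z := fun z => by
    rw [pathWeight, ← mul_assoc, ← ENNReal.ofReal_mul (div_nonneg (hν.nonneg _) (hm.pos _).le),
      div_mul_cancel₀ _ (hm.pos _).ne']
  simp_rw [h2]
  rw [hp.tsum_mul_transitionWeight b fun y => ENNReal.ofReal (ν y),
    ← ENNReal.ofReal_tsum_of_nonneg hν.nonneg hν.sum_one.summable, hν.sum_one.tsum_eq,
    ENNReal.ofReal_one]

variable [MeasurableSpace S] [DiscreteMeasurableSpace S]
  {Ω : Type*} [MeasurableSpace Ω] {X : ℤ → Ω → S}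

variable (m ν i) in
/-- The process shifted by `T_*`. -/
noncomputable def shifted (X : ℤ → Ω → S) (n : ℤ) (ω : Ω) : S :=
  -- `toNat` sends `⊤` to `0`, which only matters on a null set once `T_*` is known to be almost
  -- surely finite.
  X (n + ((Tstar m ν i fun k => X k ω).toNat : ℤ)) ω

theorem measurable_shifted (hm : ∀ j, 0 < m j) (hci : c i = 0)
    (hc : ∀ j, m i / m j * ν j = c j) (hX : ∀ n, Measurable (X n)) (n : ℤ) :
    Measurable (shifted m ν i X n) := by
  have hT : Measurable fun ω => (Tstar m ν i fun k => X k ω).toNat :=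
    (Measurable.of_discrete (f := ENat.toNat)).comp
      ((measurable_Tstar hm hci hc).comp (measurable_pi_lambda _ hX))
  have h2 : Measurable fun q : ℕ × Ω => X (n + (q.1 : ℤ)) q.2 :=
    measurable_from_prod_countable_right fun k => hX (n + (k : ℤ))
  exact h2.comp (hT.prodMk measurable_id)

variable [Countable S] {P : Measure Ω} [IsProbabilityMeasure P]

theorem measure_forall_chargeSum_pos (hp : IsStochastic p) (hm : IsStationary p m)
    (hX : IsTwoSidedMarkovChain p m (Pi.single i 1) X P) (n : ℕ) :
    P {ω | ∀ k ≤ n, 0 < chargeSum i c (fun n => X n ω) k} =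
      ENNReal.ofReal (survival p (charge i c) n i 1) := by
  classical
  let A : Set (Fin (n + 1) → S) := {z | ∀ k ≤ n,
    0 < 0 + ∑ l ∈ Finset.range (k + 1), charge i c (z (Fin.ofNat (n + 1) l))}
  have hset : {ω | ∀ k ≤ n, 0 < chargeSum i c (fun n => X n ω) k} =
      {ω | (fun r : Fin (n + 1) => X ((r : ℕ) - ((0 : ℕ) : ℤ)) ω) ∈ A} := by
    ext ω
    refine forall₂_congr fun k hk => ?_
    rw [zero_add, chargeSum]
    have : ∀ l ∈ Finset.range (k + 1), charge i c (X l ω) =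
        charge i c (X (((Fin.ofNat (n + 1) l : Fin (n + 1)) : ℕ) - ((0 : ℕ) : ℤ)) ω) := by
      intro l hl
      have := Finset.mem_range.1 hl
      simp only [Fin.val_ofNat, Nat.mod_eq_of_lt (show l < n + 1 by omega), Nat.cast_zero,
        sub_zero]
    rw [Finset.sum_congr rfl this]
  rw [hset, measure_preimage_eq_tsum P (measurable_window hX.measurable n 0) A]
  -- Starting in `i` at level `0`, the charge of time `0` raises the level to `1`.
  have h := tsum_mul_transitionWeight_survival hp (charge i c) n
    (fun y => if y = i then 1 else 0) 0
  rw [tsum_eq_single i (by intro y hy; simp [hy])] at h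
  simp only [if_true, one_mul, charge_self, zero_add] at h
  rw [← h]
  refine tsum_congr fun z => ?_
  simp only [A, Set.mem_ofPred_eq, zero_add]
  congr 1
  rw [hX.measure_window hp hm (single_nonneg i) (Nat.zero_le n), pathWeight, ← mul_assoc]
  congr 1
  have h0 : Fin.ofNat (n + 1) 0 = 0 := rfl
  rw [h0, ← ENNReal.ofReal_mul (div_nonneg (single_nonneg i _) (hm.pos _).le),
    div_mul_cancel₀ _ (hm.pos _).ne', Pi.single_apply]
  split_ifs <;> simp

theorem ae_Tstar_ne_top (hp : IsStochastic p) (hirr : p.IsIrreducible) (hrec : IsRecurrent p)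
    (hm : IsStationary p m) (hX : IsTwoSidedMarkovChain p m (Pi.single i 1) X P)
    (hci : c i = 0) (hc : ∀ j, m i / m j * ν j = c j)
    (hcs : HasSum (fun y => m y * c y) (m i)) :
    ∀ᵐ ω ∂P, Tstar m ν i (fun n => X n ω) ≠ ⊤ := by
  have hle : ∀ n, P {ω | ¬ Tstar m ν i (fun n => X n ω) ≠ ⊤} ≤
      ENNReal.ofReal (survival p (charge i c) n i 1) := fun n => by
    rw [← measure_forall_chargeSum_pos hp hm hX]
    refine measure_mono fun ω hω k _ => ?_
    exact pos_chargeSum_of_Tstar_eq_top hm.pos hci hc (not_not.1 hω) k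
  have hlim := ENNReal.tendsto_ofReal (tendsto_survival (f := charge i c) hp i 1)
  rw [eternalSurvival_eq_zero hp hirr hrec hm hci hcs, ENNReal.ofReal_zero] at hlim
  exact le_antisymm (ge_of_tendsto' hlim hle) zero_le

/-- The paths whose charge, accumulated from position `M - n` on, is nonpositive for the first time
at position `M`. -/
def matchedPaths (i : S) (c : S → ℕ) {L : ℕ} (M n : ℕ) : Set (Fin (L + 1) → S) :=
  {z | (∀ k < n, 0 < ∑ l ∈ Finset.range (k + 1),
      charge i c (z (Fin.ofNat (L + 1) (M - n + l)))) ∧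
    ∑ l ∈ Finset.range (n + 1), charge i c (z (Fin.ofNat (L + 1) (M - n + l))) ≤ 0}

-- The mass transport bound. All events are moved to one path space by placing time `0` at position
-- `M - n`, so that `T_* = n` always falls on position `M`; the bound on the number of matched
-- starts then applies path by path.
open Classical in
theorem sum_measure_Tstar_le (hp : IsStochastic p) (hm : IsStationary p m)
    (hX : IsTwoSidedMarkovChain p m (Pi.single i 1) X P)
    (hci : c i = 0) (hc : ∀ j, m i / m j * ν j = c j) (a b e : ℕ) (x : Fin (a + b + 1) → S) :
    ∑ n ∈ Finset.range (e + a + 1), P {ω | Tstar m ν i (fun n => X n ω) = n ∧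
        ∀ r : Fin (a + b + 1), X ((r : ℕ) - (a : ℤ) + n) ω = x r} ≤
      ENNReal.ofReal (ν (x (Fin.ofNat (a + b + 1) a)) / m (x (Fin.ofNat (a + b + 1) a))) *
        pathWeight p m x := by
  -- The window `x` occupies the last `a + b + 1` positions, with centre `M`; the `e` positions to
  -- its left make room for every start `M - n` with `n ≤ M`.
  set M := e + a with hM
  set L := e + (a + b) with hL
  set y := x (Fin.ofNat (a + b + 1) a) with hy
  have hmi := hm.pos i
  let E : (Fin (L + 1) → S) → Fin (a + b + 1) → S :=
    fun z r => z (Fin.ofNat (L + 1) (e + r))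
  -- Only `i` has positive charge, so the first condition says that the path is in `i` at time `0`.
  let B : ℕ → (Fin (L + 1) → S) → Prop := fun n z =>
    0 < charge i c (z (Fin.ofNat (L + 1) (M - n))) ∧ z ∈ matchedPaths i c M n
  have hstep : ∀ n ∈ Finset.range (M + 1), P {ω | Tstar m ν i (fun n => X n ω) = n ∧
        ∀ r : Fin (a + b + 1), X ((r : ℕ) - (a : ℤ) + n) ω = x r} ≤
      ∑' z : Fin (L + 1) → S, if E z = x ∧ B n z then
        ENNReal.ofReal (m i)⁻¹ * pathWeight p m z else 0 := by
    intro n hn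
    have hnM : n ≤ M := by have := Finset.mem_range.1 hn; omega
    have hset : {ω | Tstar m ν i (fun n => X n ω) = n ∧
        ∀ r : Fin (a + b + 1), X ((r : ℕ) - (a : ℤ) + n) ω = x r} =
        {ω | (fun r : Fin (L + 1) => X ((r : ℕ) - ((M - n : ℕ) : ℤ)) ω) ∈
          {z | E z = x} ∩ matchedPaths i c M n} := by
      ext ω
      have hmod : ∀ r ≤ L, ((Fin.ofNat (L + 1) r : Fin (L + 1)) : ℕ) = r := fun r hr =>
        Nat.mod_eq_of_lt (by omega)
      have hsum : ∀ k ≤ n, ∑ l ∈ Finset.range (k + 1), charge i c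
          (X (((Fin.ofNat (L + 1) (M - n + l) : Fin (L + 1)) : ℕ) - ((M - n : ℕ) : ℤ)) ω) =
          chargeSum i c (fun n => X n ω) k := by
        intro k hk
        refine Finset.sum_congr rfl fun l hl => ?_
        have := Finset.mem_range.1 hl
        rw [hmod _ (by omega)]
        congr 2
        push_cast
        ring
      simp only [Set.mem_ofPred_eq, Set.mem_inter_iff, matchedPaths, E, funext_iff]
      rw [Tstar_eq_coe_iff hm.pos hci hc, and_comm, hsum n le_rfl]
      refine and_congr (forall_congr' fun r => ?_) (and_congr_left fun _ => ?_)
      · rw [hmod _ (by omega), show (((e + r : ℕ) : ℤ) - ((M - n : ℕ) : ℤ)) = (r : ℕ) - (a : ℤ) + n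
          by omega]
      · exact forall₂_congr fun k hk => by rw [hsum k hk.le]
    rw [hset, measure_preimage_eq_tsum P (measurable_window hX.measurable L (M - n))]
    refine ENNReal.tsum_le_tsum fun z => ?_
    rw [hX.measure_window hp hm (single_nonneg i) (by omega)]
    by_cases hz : z (Fin.ofNat (L + 1) (M - n)) = i
    · simp only [B, hz, charge_self, Int.zero_lt_one, true_and, Pi.single_eq_same, one_div]
      exact le_rfl
    · rw [Pi.single_eq_of_ne hz]
      simp
  have hcount : ∀ z : Fin (L + 1) → S, ∑ n ∈ Finset.range (M + 1),
      (if E z = x ∧ B n z then ENNReal.ofReal (m i)⁻¹ * pathWeight p m z else 0) ≤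
      (if E z = x then ENNReal.ofReal (m i)⁻¹ * (c y : ℝ≥0∞) else 0) * pathWeight p m z := by
    intro z
    by_cases hz : E z = x
    · simp only [hz, true_and, if_true]
      rw [← Finset.sum_filter, Finset.sum_const, nsmul_eq_mul, mul_assoc, mul_left_comm]
      refine mul_le_mul' le_rfl (mul_le_mul' ?_ le_rfl)
      have h := card_filter_first_nonpos_le
        (fun r => charge i c (z (Fin.ofNat (L + 1) r))) M
      have hzM : z (Fin.ofNat (L + 1) M) = y := by
        rw [hy, ← hz]
        simp only [E, Fin.val_ofNat, Nat.mod_eq_of_lt (show a < a + b + 1 by omega), hM]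
      simp only [hzM, toNat_neg_charge hci] at h
      exact Nat.cast_le.2 (by convert h; rfl)
    · simp [hz]
  calc _ ≤ ∑ n ∈ Finset.range (M + 1), ∑' z : Fin (L + 1) → S, (if E z = x ∧ B n z then
        ENNReal.ofReal (m i)⁻¹ * pathWeight p m z else 0) := Finset.sum_le_sum hstep
    _ = ∑' z : Fin (L + 1) → S, ∑ n ∈ Finset.range (M + 1), (if E z = x ∧ B n z then
        ENNReal.ofReal (m i)⁻¹ * pathWeight p m z else 0) :=
      (Summable.tsum_finsetSum fun _ _ => ENNReal.summable).symm
    _ ≤ ∑' z : Fin (L + 1) → S, (if E z = x then ENNReal.ofReal (m i)⁻¹ * (c y : ℝ≥0∞) else 0) *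
        pathWeight p m z := ENNReal.tsum_le_tsum hcount
    _ = ENNReal.ofReal (m i)⁻¹ * (c y : ℝ≥0∞) * pathWeight p m x := by
      rw [tsum_mul_pathWeight hp hm e L hL (fun u : Fin (a + b + 1) → S =>
        if u = x then ENNReal.ofReal (m i)⁻¹ * (c y : ℝ≥0∞) else 0),
        tsum_eq_single x (by intro u hu; simp [hu])]
      simp
    _ = _ := by
      congr 1
      rw [← ENNReal.ofReal_natCast, ← ENNReal.ofReal_mul (inv_nonneg.2 hmi.le), ← hc]
      congr 1
      field_simp

theorem measure_shifted_window_le (hp : IsStochastic p) (hm : IsStationary p m)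
    (hX : IsTwoSidedMarkovChain p m (Pi.single i 1) X P)
    (hci : c i = 0) (hc : ∀ j, m i / m j * ν j = c j)
    (hT : ∀ᵐ ω ∂P, Tstar m ν i (fun n => X n ω) ≠ ⊤) (a b : ℕ) (x : Fin (a + b + 1) → S) :
    P {ω | (fun r : Fin (a + b + 1) => shifted m ν i X ((r : ℕ) - (a : ℤ)) ω) = x} ≤
      ENNReal.ofReal (ν (x (Fin.ofNat (a + b + 1) a)) / m (x (Fin.ofNat (a + b + 1) a))) *
        pathWeight p m x := by
  let A : ℕ → Set Ω := fun n => {ω | Tstar m ν i (fun n => X n ω) = n ∧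
        ∀ r : Fin (a + b + 1), X ((r : ℕ) - (a : ℤ) + n) ω = x r}
  have h1 : P {ω | (fun r : Fin (a + b + 1) => shifted m ν i X ((r : ℕ) - (a : ℤ)) ω) = x} ≤
      P (⋃ n, A n) := by
    refine measure_mono_ae ?_
    filter_upwards [hT] with ω hω h
    obtain ⟨n, hn⟩ := ENat.ne_top_iff_exists.1 hω
    refine Set.mem_iUnion.2 ⟨n, hn.symm, fun r => ?_⟩
    have h2 := congrFun h r
    simpa only [shifted, ← hn, ENat.toNat_natCast] using h2
  refine h1.trans ((measure_iUnion_le A).trans ?_)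
  refine ENNReal.tsum_le_of_sum_range_le fun n => ?_
  -- The bound does not depend on `e`, so `e = n` covers the first `n` terms.
  refine le_trans ?_ (sum_measure_Tstar_le hp hm hX hci hc a b n x)
  exact Finset.sum_le_sum_of_subset (Finset.range_mono (by omega))

/-- No lower bound is needed: the window law of the shifted process and the target law both have
total mass one, so the pointwise inequality is an equality. -/
theorem isTwoSidedMarkovChain_shifted (hp : IsStochastic p) (hm : IsStationary p m)
    (hX : IsTwoSidedMarkovChain p m (Pi.single i 1) X P) (hν : IsProbability ν)
    (hci : c i = 0) (hc : ∀ j, m i / m j * ν j = c j)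
    (hT : ∀ᵐ ω ∂P, Tstar m ν i (fun n => X n ω) ≠ ⊤) :
    IsTwoSidedMarkovChain p m ν (shifted m ν i X) P := by
  have hmeas := measurable_shifted hm.pos hci hc hX.measurable
  refine ⟨hmeas, fun a b x => ?_⟩
  have htot : ∑' z : Fin (a + b + 1) → S,
      P {ω | (fun r : Fin (a + b + 1) => shifted m ν i X ((r : ℕ) - (a : ℤ)) ω) = z} = 1 := by
    have h := measure_preimage_eq_tsum P (measurable_window hmeas (a + b) a) Set.univ
    simpa using h.symm
  have heq := eq_of_le_of_tsum_eq_one (measure_shifted_window_le hp hm hX hci hc hT a b) htot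
    (tsum_window_weight hp hm hν a b) fun r : Fin (a + b + 1) => x ((r : ℕ) - (a : ℤ))
  have hset : {ω | ∀ k : ℤ, -(a : ℤ) ≤ k → k ≤ (b : ℤ) → shifted m ν i X k ω = x k} =
      {ω | (fun r : Fin (a + b + 1) => shifted m ν i X ((r : ℕ) - (a : ℤ)) ω) =
        fun r : Fin (a + b + 1) => x ((r : ℕ) - (a : ℤ))} := by
    ext ω
    simp only [Set.mem_ofPred_eq, funext_iff]
    constructor
    · intro h r
      exact h _ (by omega) (by omega)
    · intro h k h1 h2
      have h3 := h ⟨(k + a).toNat, by omega⟩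
      rwa [show (((⟨(k + a).toNat, by omega⟩ : Fin (a + b + 1)) : ℕ) : ℤ) - a = k by
        simp only []; omega] at h3
  have ha : (((Fin.ofNat (a + b + 1) a : Fin (a + b + 1)) : ℕ) : ℤ) - a = 0 := by
    simp [Nat.mod_eq_of_lt (show a < a + b + 1 by omega)]
  have hnn : 0 ≤ ν (x 0) / m (x 0) := div_nonneg (hν.nonneg _) (hm.pos _).le
  rw [cylinder_weight_eq hm, Measure.real, hset, heq]
  simp only [ha]
  rw [pathWeight_eq_ofReal hp hm, ← ENNReal.ofReal_mul hnn, ENNReal.toReal_ofReal]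
  exact mul_nonneg hnn (mul_nonneg (hm.pos _).le (Finset.prod_nonneg fun _ _ => hp.nonneg _ _))

end Main

end TwoSidedChain

theorem theorem2 {S : Type*} [Countable S] [DecidableEq S] [MeasurableSpace S]
    [DiscreteMeasurableSpace S] {Ω : Type*} [MeasurableSpace Ω]
    (p : Matrix S S ℝ) (hp : TwoSidedChain.IsStochastic p) (hirr : p.IsIrreducible)
    (hrec : TwoSidedChain.IsRecurrent p)
    (m : S → ℝ) (hm : TwoSidedChain.IsStationary p m)
    (i : S) (X : ℤ → Ω → S) (P : Measure Ω) [IsProbabilityMeasure P]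
    (hX : TwoSidedChain.IsTwoSidedMarkovChain p m (Pi.single i 1) X P)
    (ν : S → ℝ) (hν : TwoSidedChain.IsProbability ν) (hνi : ν i = 0)
    (hint : ∀ j, ∃ z : ℤ, m i / m j * ν j = (z : ℝ)) :
    -- `T_*` is almost surely finite
    (∀ᵐ ω ∂P, TwoSidedChain.Tstar m ν i (fun n => X n ω) ≠ ⊤) ∧
    -- `T_*` is non-randomized: a measurable function of the trajectory
    Measurable (TwoSidedChain.Tstar m ν i) ∧
    -- `T_*` is a stopping time
    IsStoppingTime (TwoSidedChain.forwardFiltration X hX.measurable)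
      (fun ω => TwoSidedChain.Tstar m ν i (fun n => X n ω)) ∧
    -- `T_*` is an unbiased shift embedding `ν`
    TwoSidedChain.IsTwoSidedMarkovChain p m ν
      (fun n ω => X (n + ((TwoSidedChain.Tstar m ν i (fun k => X k ω)).toNat : ℤ)) ω) P := by
  have hnat : ∀ j, ∃ k : ℕ, m i / m j * ν j = (k : ℝ) := fun j => by
    obtain ⟨z, hz⟩ := hint j
    have h0 : (0 : ℝ) ≤ z :=
      hz ▸ mul_nonneg (div_nonneg (hm.pos i).le (hm.pos j).le) (hν.nonneg j)
    obtain ⟨k, rfl⟩ := Int.eq_ofNat_of_zero_le (Int.cast_nonneg_iff.1 h0)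
    exact ⟨k, by simpa using hz⟩
  choose c hc using hnat
  have hci : c i = 0 := by
    have h := hc i
    rw [hνi, mul_zero] at h
    exact_mod_cast h.symm
  -- Balance of charges: `m y * c y = m i * ν y`, and `ν` has mass one.
  have hcs : HasSum (fun y => m y * (c y : ℝ)) (m i) := by
    have h := hν.sum_one.mul_left (m i)
    rw [mul_one] at h
    refine (funext fun y => ?_ : (fun y => m y * (c y : ℝ)) = _) ▸ h
    rw [← hc y]
    field_simp [(hm.pos y).ne']
  have hT := TwoSidedChain.ae_Tstar_ne_top hp hirr hrec hm hX hci hc hcs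
  exact ⟨hT, TwoSidedChain.measurable_Tstar hm.pos hci hc,
    TwoSidedChain.isStoppingTime_Tstar hm.pos hci hc hX.measurable,
    TwoSidedChain.isTwoSidedMarkovChain_shifted hp hm hX hν hci hc hT⟩
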